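/- **Setting.** Let $R,C$ be finite index sets with $|R|=|C|=n$, $\mathbb T\subseteq\mathbb R$ a nonempty open interval, $\Omega\subseteq\mathbb R^{(l+1)n}$ a nonempty open set with coordinates $x_j^{(k)}$ ($j\in C$, $0\le k\le l$), and $F=(F_i)_{i\in R}:\mathbb T\times\Omega\to\mathbb R^n$ real analytic. Consider the DAE $F(t,x,\dot x,\dots,x^{(l)})=0$. Formal derivatives are $\dot f=\partial f/\partial t+\sum_{j,k}(\partial f/\partial x_j^{(k)})\,x_j^{(k+1)}$, and $f^{(d)}$ is defined on $\mathbb T\times\Omega^{(d)}$, $\Omega^{(d)}=\Omega\times\mathbb R^{dn}$. Let $c_{i,j}$ be the largest $k$ such that $\partial F_i/\partial x_j^{(k)}\not\equiv0$ on the domain; $(i,j)$ is an edge of the bipartite graph $G(F)$ if such $k$ exists. The dual problem is to minimize $\sum_j q_j-\sum_i p_i$ over integers subject to $q_j-p_i\ge c_{i,j}$ on all edges; $\hat\delta(F)$ is its optimal value, or $-\infty$ if it has no optimal solution. The same notions are used for systems in which the maximal order of the derivatives differs between variables. The system Jacobian for $(p,q)$ is $D_{i,j}=\partial F_i^{(p_i)}/\partial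 x_j^{(q_j)}=\partial F_i/\partial x_j^{(q_j-p_i)}$ (zero if $q_j-p_i\notin\{0,\dots,l\}$). A consistent point is a point $(t,X)\in\mathbb T\times\Omega$ through which a $C^\infty$ solution, defined on an open interval containing $t$, passes, i.e. $X$ is the vector of its derivatives of order $0,\dots,l$ at $t$. Assume (I1) $G(F)$ has a perfect matching. For a dual optimal solution $(p,q)$ with system Jacobian $D$ consider: (I2) every square submatrix of $D$ that is not identically singular on $\mathbb T\times\Omega$ is nonsingular at some consistent point; (I3) $D$ is identically singular. **Method.** Given a dual optimal $(p,q)$, choose $r\in R$, $I\subseteq R\setminus\{r\}$, $J\subseteq C$ with $|I|=|J|=:m$ such that (C1) $D[I,J]$ is not identically singular, (C2) the maximum size of a not identically singular square submatrix of $D[I\cup\{r\},C]$ is $m$, and (C3) $p_r\le p_i$ for $i\in I$. Let $T=C\setminus J$ and $\kappa=\max_{i\in I}p_i-p_r$ ($\kappa=0$ if $I=\emptyset$). Regard $\Omega^{(\kappa)}$ as a subset of $\mathbb R^{\mathcal C}$, $\mathcal C=C\times\{0,\dots,l+\kappa\}$, and put $\mathcal J=\{(j,q_j-p_r): j\in J\}$.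 Choose an implicit-function neighbourhood: an open interval $\bar{\mathbb T}\subseteq\mathbb T$, an open convex $V\subseteq\mathbb R^{\mathcal C\setminus\mathcal J}$ and an open $W\subseteq\mathbb R^{\mathcal J}$ with $\bar\Omega:=V\times W\subseteq\Omega^{(\kappa)}$, such that $\bar{\mathbb T}\times\bar\Omega$ contains a common zero of the functions $F_i^{(p_i-p_r)}$ ($i\in I$), and a real analytic $\phi:\bar{\mathbb T}\times V\to W$ such that, on $\bar{\mathbb T}\times\bar\Omega$, $F_i^{(p_i-p_r)}(t,X)=0$ for all $i\in I$ if and only if $X_{\mathcal J}=\phi(t,X_{\mathcal C\setminus\mathcal J})$, and $D[I,J]$ is nonsingular at these points. Choose $\Xi\in\bar\Omega$. For $y\in\mathbb R^{J}$ let $\psi_\Xi(X,y)$ arise from $X$ by replacing the coordinate $x_j^{(q_j-p_r)}$ by $y_j$ for $j\in J$ and by the constant $\Xi_{(j,q_j-p_r)}$ for $j\in T$. The output is the DAE $F^{\rm aug}(t,x,\dots,x^{(l+\kappa)},y)=0$ with $n+m$ equations $$F_r(t,\psi_\Xi(X,y))=0,\qquad F_i(t,x,\dots,x^{(l)})=0\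 (i\in R\setminus\{r\}),\qquad F_i^{(p_i-p_r)}(t,\psi_\Xi(X,y))=0\ (i\in I),$$ the last family being indexed by a copy $I'$ of $I$, with the $n+m$ unknowns $x$, $y$, on the domain consisting of $t\in\bar{\mathbb T}$ and of the $(X,y)$ with $X\in\bar\Omega$ and $\psi_\Xi(X,y)\in\bar\Omega$. **Theorem.** Assume (I1). There is a dual optimal solution with $0\le p_i,q_j\le nl$ for all $i,j$. Let $(p,q)$ be any dual optimal solution for which (I2) and (I3) hold. Then a triple $(r,I,J)$ with (C1)–(C3) exists; for every such triple an implicit-function neighbourhood exists; and for all such choices and every $\Xi\in\bar\Omega$ (where $\bar{\mathbb T},\bar\Omega\neq\emptyset$): (A1) $F^{\rm aug}$ is real analytic on its domain, which is a nonempty open set of the form $\bar{\mathbb T}\times\Omega^{\rm aug}\times Y\subseteq\mathbb T\times\Omega^{(\kappa)}\times\mathbb R^m$ with $\bar{\mathbb T}$ an open interval and $\Omega^{\rm aug}$, $Y$ open; $m\le n-1$; and $\kappa\le ln$ provided that $0\le p_i,q_j\le nl$ for all $i,j$. (A2) Let $s\in\{0,1,2,\dots,\infty\}$, let $x:\bar{\mathbb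 T}\to\mathbb R^n$ be of class $C^{l+\kappa+s}$, let $t^*\in\bar{\mathbb T}$ and let $(X^*,y^*)\in\Omega^{\rm aug}\times Y$ with $(x(t^*),\dot x(t^*),\dots,x^{(l+\kappa)}(t^*))=X^*$. Then there is an open interval $\mathbb I\subseteq\bar{\mathbb T}$ containing $t^*$ such that $x$ is a solution of $F=0$ on $\mathbb I$ if and only if there is a $C^s$ function $y:\mathbb I\to\mathbb R^m$ such that $(x,y)$ is a solution of $F^{\rm aug}=0$ on $\mathbb I$ and $y$ is the only continuous function with this property. (A3) Put $\bar p_i=p_i$ ($i\in R$), $\bar p_{i'}=p_r$ ($i'\in I'$), $\bar q_j=q_j$ for the variables $x_j$ ($j\in C$) and $\bar q_{j'}=p_r$ for the variables $y_j$ ($j\in J$). Then $(\bar p,\bar q)$ is feasible but not optimal for the dual problem of $F^{\rm aug}$, and $\hat\delta(F^{\rm aug})\le\hat\delta(F)-1$. -/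

import Mathlib

noncomputable section

namespace DAE

/-- The formal arguments `x_j^{(k)}` with `j : C` and `0 ≤ k ≤ N j`; the coordinate `⟨j, k⟩` stands
for `x_j^{(k)}`. -/
abbrev Coord {C : Type*} (N : C → ℕ) : Type _ := Σ j : C, Fin (N j + 1)

/-- The space of jets `(x_j^{(k)})`, where the variable `x_j` occurs up to the order `N j`. -/
abbrev Jet {C : Type*} (N : C → ℕ) : Type _ := Coord N → ℝ

namespace Jet

variable {C : Type*}

/-- Forgetting the derivatives of high order. -/
def restrict {N M : C → ℕ} (h : ∀ j, N j ≤ M j) (X : Jet M) : Jet N :=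
  fun c => X ⟨c.1, Fin.castLE (Nat.succ_le_succ (h c.1)) c.2⟩

/-- The formal time derivative of the jet: the coordinate `x_j^{(k)}` becomes `x_j^{(k+1)}`. -/
def shift {N : C → ℕ} (X : Jet (fun j => N j + 1)) : Jet N :=
  fun c => X ⟨c.1, c.2.succ⟩

/-- The jet at time `t` of a trajectory `z`. -/
def ofTrajectory (N : C → ℕ) (z : ℝ → C → ℝ) (t : ℝ) : Jet N :=
  fun c => iteratedDeriv (c.2 : ℕ) (fun s => z s c.1) t

end Jet

section Calculus

variable {C : Type*} [Fintype C] {N : C → ℕ}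

/-- The partial derivative of `f(t, X)` with respect to the argument `c = x_j^{(k)}`. -/
def pderiv [DecidableEq C] (f : ℝ × Jet N → ℝ) (c : Coord N) (z : ℝ × Jet N) : ℝ :=
  fderiv ℝ f z (0, Pi.single c 1)

/-- The formal derivative `ḟ = ∂f/∂t + ∑_{j,k} ∂f/∂x_j^{(k)} · x_j^{(k+1)}`: the differential of `f`
at `(t, x, …, x^{(l)})` applied to the vector `(1, ẋ, …, x^{(l+1)})`. -/
def totalDeriv (f : ℝ × Jet N → ℝ) (z : ℝ × Jet (fun j => N j + 1)) : ℝ :=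
  fderiv ℝ f (z.1, Jet.restrict (fun j => Nat.le_succ (N j)) z.2) (1, Jet.shift z.2)

/-- The `d`-th formal derivative `f^{(d)}`. -/
def iterDeriv (f : ℝ × Jet N → ℝ) : (d : ℕ) → ℝ × Jet (fun j => N j + d) → ℝ
  | 0 => f
  | d + 1 => totalDeriv (iterDeriv f d)

end Calculus

/-- A square matrix of reals, whose rows and columns may be indexed by different types, is
nonsingular: its determinant (defined up to sign) does not vanish. -/
def Nonsing {A B : Type*} [Fintype A] [DecidableEq A] (M : Matrix A B ℝ) : Prop :=
  ∃ e : A ≃ B, (M.submatrix id e).det ≠ 0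

/-- The data of a system of equations `F_i(t, (x_j^{(k)})_{j, k ≤ N j}) = 0` for `i : R`, where `F` is
considered on `time × dom`. -/
structure System (R : Type*) {C : Type*} (N : C → ℕ) where
  time : Set ℝ
  dom : Set (Jet N)
  eqn : R → ℝ × Jet N → ℝ

namespace System

/-- `κ = max_{i ∈ I} p_i - p_r` (only used when `p_r ≤ p_i` for `i ∈ I`). -/
def kappa {R : Type*} (p : R → ℤ) (r : R) (I : Finset R) : ℕ := I.sup fun i => (p i - p r).toNat

theorem toNat_le_kappa {R : Type*} (p : R → ℤ) (r : R) (I : Finset R) (i : I) :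
    (p i - p r).toNat ≤ kappa p r I :=
  Finset.le_sup (f := fun i => (p i - p r).toNat) i.2

variable {R C : Type*} [Fintype R] [DecidableEq R] [Fintype C] [DecidableEq C]

section General

variable {N : C → ℕ} (E : System R N)

/-- `time` is a nonempty open interval, `dom` is a nonempty open set, and `F` is real analytic on
`time × dom`. -/
def IsRealAnalytic : Prop :=
  IsOpen E.time ∧ E.time.OrdConnected ∧ E.time.Nonempty ∧ IsOpen E.dom ∧ E.dom.Nonempty ∧
    ∀ i, AnalyticOnNhd ℝ (E.eqn i) (E.time ×ˢ E.dom)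

/-- `z` solves the DAE on the set `S` of times. -/
def IsSolutionOn (z : ℝ → C → ℝ) (S : Set ℝ) : Prop :=
  (∀ j, ContDiffOn ℝ (N j) (fun t => z t j) S) ∧
    ∀ t ∈ S, t ∈ E.time ∧ Jet.ofTrajectory N z t ∈ E.dom ∧
      ∀ i, E.eqn i (t, Jet.ofTrajectory N z t) = 0

/-- `(t, X)` is a consistent point: a smooth solution passes through it. -/
def IsConsistent (a : ℝ × Jet N) : Prop :=
  ∃ (S : Set ℝ) (z : ℝ → C → ℝ), IsOpen S ∧ S.OrdConnected ∧ a.1 ∈ S ∧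
    ContDiffOn ℝ (⊤ : ℕ∞) z S ∧ E.IsSolutionOn z S ∧ Jet.ofTrajectory N z a.1 = a.2

/-- `F_i` depends on the argument `c`. -/
def DependsOn (i : R) (c : Coord N) : Prop :=
  ∃ z ∈ E.time ×ˢ E.dom, pderiv (E.eqn i) c z ≠ 0

open Classical in
/-- The maximal order of a derivative of `x_j` on which `F_i` depends; `⊥` stands for `-∞`. -/
def ord (i : R) (j : C) : WithBot ℕ :=
  Finset.univ.sup fun k : Fin (N j + 1) =>
    if E.DependsOn i ⟨j, k⟩ then (((k : ℕ) : ℕ) : WithBot ℕ) else ⊥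

/-- `(i, j)` is an edge of the bipartite graph `G(F)`. -/
def IsEdge (i : R) (j : C) : Prop := E.ord i j ≠ ⊥

/-- `G(F)` has a perfect matching. -/
def HasPerfectMatching : Prop := ∃ σ : R ≃ C, ∀ i, E.IsEdge i (σ i)

/-- `(p, q)` is feasible for the dual problem: `q_j - p_i ≥ c_{i,j}` on all edges, where `c_{i,j}` is
the order of `x_j` in `F_i`. -/
def IsDualFeasible (p : R → ℤ) (q : C → ℤ) : Prop :=
  ∀ i j, ∀ c : ℕ, E.ord i j = (c : WithBot ℕ) → (c : ℤ) ≤ q j - p i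

/-- The objective function of the dual problem. -/
def dualValue (p : R → ℤ) (q : C → ℤ) : ℤ := ∑ j, q j - ∑ i, p i

/-- `(p, q)` is an optimal solution of the dual problem. -/
def IsDualOptimal (p : R → ℤ) (q : C → ℤ) : Prop :=
  E.IsDualFeasible p q ∧ ∀ p' q', E.IsDualFeasible p' q' → dualValue p q ≤ dualValue p' q'

open Classical in
/-- The optimal value of the dual problem, or `-∞` if it has no optimal solution. -/
def deltaHat : WithBot ℤ :=
  if h : ∃ pq : (R → ℤ) × (C → ℤ), E.IsDualOptimal pq.1 pq.2 then
    ((dualValue h.choose.1 h.choose.2 : ℤ) : WithBot ℤ)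
  else ⊥

/-- The system Jacobian `D_{i,j} = ∂F_i / ∂x_j^{(q_j - p_i)}`, which is `0` where `x_j^{(q_j - p_i)}` is
not an argument of `F`. -/
def jacobian (p : R → ℤ) (q : C → ℤ) (z : ℝ × Jet N) : Matrix R C ℝ :=
  Matrix.of fun i j =>
    ∑ k : Fin (N j + 1), if ((k : ℕ) : ℤ) = q j - p i then pderiv (E.eqn i) ⟨j, k⟩ z else 0

/-- The submatrix `D[A, B]` is nonsingular at the point `z`. -/
def NonsingAt (p : R → ℤ) (q : C → ℤ) (A : Finset R) (B : Finset C) (z : ℝ × Jet N) : Prop :=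
  Nonsing ((E.jacobian p q z).submatrix (fun i : A => (i : R)) (fun j : B => (j : C)))

/-- The submatrix `D[A, B]` is not identically singular. -/
def NotIdenticallySingular (p : R → ℤ) (q : C → ℤ) (A : Finset R) (B : Finset C) : Prop :=
  ∃ z ∈ E.time ×ˢ E.dom, E.NonsingAt p q A B z

/-- Every square submatrix of `D` that is not identically singular is nonsingular at some consistent
point. -/
def NonsingAtConsistent (p : R → ℤ) (q : C → ℤ) : Prop :=
  ∀ (A : Finset R) (B : Finset C), A.card = B.card → E.NotIdenticallySingular p q A B →
    ∃ z ∈ E.time ×ˢ E.dom, E.IsConsistent z ∧ E.NonsingAt p q A B z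

/-- `D` is singular at every point. -/
def JacobianIdenticallySingular (p : R → ℤ) (q : C → ℤ) : Prop :=
  ∀ z ∈ E.time ×ˢ E.dom, ¬ Nonsing (E.jacobian p q z)

/-- The triple `(r, I, J)` satisfies (C1): `D[I, J]` is nonsingular, (C2): `D[I ∪ {r}, C]` has rank
`|I|`, and (C3): `p_r ≤ p_i` for `i ∈ I`. Nonsingularity and rank are the generic ones: a submatrix is
nonsingular if it is not identically singular. -/
structure IsAdmissible (p : R → ℤ) (q : C → ℤ) (r : R) (I : Finset R) (J : Finset C) : Prop where
  notMem : r ∉ I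
  card_eq : I.card = J.card
  nonsingular : E.NotIdenticallySingular p q I J
  rank_eq : IsGreatest {m : ℕ | ∃ (A : Finset R) (B : Finset C), A ⊆ insert r I ∧
    A.card = m ∧ B.card = m ∧ E.NotIdenticallySingular p q A B} I.card
  le : ∀ i ∈ I, p r ≤ p i

end General

section Method

variable {l : ℕ} (E : System R (fun _ : C => l)) (p : R → ℤ) (q : C → ℤ) (r : R) (I : Finset R)
  (J : Finset C)

/-- The jets `(x, ẋ, …, x^{(l + κ)})`. -/
abbrev ExtJet (_C : Type*) (l : ℕ) (p : R → ℤ) (r : R) (I : Finset R) : Type _ :=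
  Jet (fun _ : _C => l + kappa p r I)

/-- The set `Ω^{(κ)}`. -/
def extDom : Set (ExtJet C l p r I) :=
  {X | Jet.restrict (fun _ => Nat.le_add_right l _) X ∈ E.dom}

/-- The function `F_i^{(p_i - p_r)}` for `i ∈ I`, as a function of `(t, x, …, x^{(l + κ)})`. -/
def diffEqn (i : I) (z : ℝ × ExtJet C l p r I) : ℝ :=
  iterDeriv (E.eqn i) (p i - p r).toNat
    (z.1, Jet.restrict (fun _ => Nat.add_le_add_left (toNat_le_kappa p r I i) l) z.2)

/-- The coordinates `x_j^{(q_j - p_r)}` for `j ∈ J`. -/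
def topCoords (l : ℕ) : Finset (Coord (fun _ : C => l + kappa p r I)) :=
  Finset.univ.filter fun c => c.1 ∈ J ∧ ((c.2 : ℕ) : ℤ) = q c.1 - p r

/-- An application of the implicit function theorem that solves `F_i^{(p_i - p_r)} = 0` (`i ∈ I`) for the
coordinates `x_j^{(q_j - p_r)}` (`j ∈ J`) as an analytic function `phi` of the time and of the remaining
coordinates, on a product neighbourhood `time × V × W` of a zero. -/
structure ImplicitSolution where
  time : Set ℝ
  V : Set (((topCoords p q r I J l)ᶜ : Finset _) → ℝ)
  W : Set (topCoords p q r I J l → ℝ)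
  phi : ℝ × (((topCoords p q r I J l)ᶜ : Finset _) → ℝ) → (topCoords p q r I J l → ℝ)
  base : ℝ × ExtJet C l p r I
  isOpen_time : IsOpen time
  ordConnected_time : time.OrdConnected
  isOpen_V : IsOpen V
  convex_V : Convex ℝ V
  isOpen_W : IsOpen W
  time_subset : time ⊆ E.time
  subset_extDom : ∀ X : ExtJet C l p r I,
    (topCoords p q r I J l)ᶜ.restrict X ∈ V → (topCoords p q r I J l).restrict X ∈ W →
      X ∈ E.extDom p r I
  base_time_mem : base.1 ∈ time
  base_V_mem : (topCoords p q r I J l)ᶜ.restrict base.2 ∈ V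
  base_W_mem : (topCoords p q r I J l).restrict base.2 ∈ W
  base_zero : ∀ i, E.diffEqn p r I i base = 0
  analyticOnNhd_phi : AnalyticOnNhd ℝ phi (time ×ˢ V)
  mapsTo_phi : Set.MapsTo phi (time ×ˢ V) W
  zero_iff : ∀ t ∈ time, ∀ X : ExtJet C l p r I,
    (topCoords p q r I J l)ᶜ.restrict X ∈ V → (topCoords p q r I J l).restrict X ∈ W →
      ((∀ i, E.diffEqn p r I i (t, X) = 0) ↔
        (topCoords p q r I J l).restrict X = phi (t, (topCoords p q r I J l)ᶜ.restrict X))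
  nonsing : ∀ t ∈ time, ∀ X : ExtJet C l p r I,
    (topCoords p q r I J l)ᶜ.restrict X ∈ V →
      (topCoords p q r I J l).restrict X = phi (t, (topCoords p q r I J l)ᶜ.restrict X) →
        E.NonsingAt p q I J (t, Jet.restrict (fun _ => Nat.le_add_right l _) X)

variable {E p q r I J} in
/-- The set of jets with coordinates in `V × W`. -/
def ImplicitSolution.dom (S : E.ImplicitSolution p q r I J) : Set (ExtJet C l p r I) :=
  {X | (topCoords p q r I J l)ᶜ.restrict X ∈ S.V ∧ (topCoords p q r I J l).restrict X ∈ S.W}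

/-- The map `ψ_Ξ(X, y)`: the coordinate `x_j^{(q_j - p_r)}` of `X` is replaced by `y_j` for `j ∈ J` and by
the constant `Ξ_{(j, q_j - p_r)}` for `j ∉ J`. -/
def psi (Ξ X : ExtJet C l p r I) (y : J → ℝ) : ExtJet C l p r I := fun c =>
  if ((c.2 : ℕ) : ℤ) = q c.1 - p r then
    if h : c.1 ∈ J then y ⟨c.1, h⟩ else Ξ c
  else X c

/-- The orders in the augmented system: `l + κ` for `x_j` and `0` for the new variables `y_j`. -/
abbrev augOrder (l : ℕ) : C ⊕ J → ℕ := Sum.elim (fun _ => l + kappa p r I) (fun _ => 0)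

variable {p r I J} in
/-- The component `X = (x, ẋ, …, x^{(l + κ)})` of a jet of the augmented system. -/
def xPart (Z : Jet (augOrder (C := C) p r I J l)) : ExtJet C l p r I :=
  fun c => Z ⟨Sum.inl c.1, c.2⟩

variable {p r I J} in
/-- The component `y` of a jet of the augmented system. -/
def yPart (Z : Jet (augOrder (C := C) p r I J l)) : J → ℝ :=
  fun j => Z ⟨Sum.inr j, (0 : Fin 1)⟩

variable {E p q r I J} in
/-- The output of the augmentation method. Its equations are indexed by `R` and a copy of `I`, its
variables are `x_j` for `j : C` and the new variables `y_j` for `j ∈ J`. -/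
def augmentation (S : E.ImplicitSolution p q r I J) (Ξ : ExtJet C l p r I) :
    System (R ⊕ I) (augOrder (C := C) p r I J l) where
  time := S.time
  dom := {Z | xPart Z ∈ S.dom ∧ psi p q r I J Ξ (xPart Z) (yPart Z) ∈ S.dom}
  eqn
    | Sum.inl i, z =>
      if i = r then
        E.eqn r (z.1, Jet.restrict (fun _ => Nat.le_add_right l _)
          (psi p q r I J Ξ (xPart z.2) (yPart z.2)))
      else E.eqn i (z.1, Jet.restrict (fun _ => Nat.le_add_right l _) (xPart z.2))
    | Sum.inr i, z => E.diffEqn p r I i (z.1, psi p q r I J Ξ (xPart z.2) (yPart z.2))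

end Method

end System

end DAE

end

/-!
**The dual problem.** An optimal solution exists because the objective is an integer that a perfect
matching bounds from below. By Hall's theorem the tight edges of an optimal solution contain a perfect
matching (`IsDualOptimal.exists_tight`). An optimal solution with `p ≥ 0` and minimal `∑ p_i` has no gap
larger than `l` between consecutive values of `p`, since the part above such a gap could be lowered along
the matching; this gives the bound `nl`.

**The triple.** A minimal set of rows of `D` that are generically dependent, with its row of least `p_r`
singled out, is admissible (`exists_isAdmissible`).

**The key derivative formula.** If `f` depends on `x_j^{(k)}` only for `k ≤ e`, then `f^{(d)}` depends on
it only for `k ≤ e + d`, and `∂f^{(d)}/∂x_j^{(e+d)} = ∂f/∂x_j^{(e)}` (`coordDeriv_iterDeriv`). Hence the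
matrix of the partial derivatives of the functions `F_i^{(p_i - p_r)}`, `i ∈ I`, with respect to the
coordinates `x_j^{(q_j - p_r)}`, `j ∈ C`, is `D[I, C]`. At a consistent point where `D[I, J]` is
nonsingular, the higher derivatives of the solution give a common zero of these functions, and the
analytic implicit function theorem applies (`nonempty_implicitSolution`).

**Equivalence of the solutions.** On the common zero set of the functions `F_i^{(p_i - p_r)}`, the
function `F_r` does not depend on the coordinates `x_j^{(q_j - p_r)}` (`extEqn_eq_of_agree`): along a
segment in these coordinates, which stays in the convex set `V`, the velocity is annihilated by the
rows of `D` in `I`, and the row `r` is a linear combination of these by the rank condition on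
`D[I ∪ {r}, C]`. For a solution `x` of the original system, its jet and the jet `ψ_Ξ(X, y)` both lie on
this zero set and differ in these coordinates only, so `F_r` vanishes at one of them if and only if it
vanishes at the other. The unknown `y` is given by the implicit function (`augmentation_solutions`).

**Decrease of the dual value.** In the `|I| + 1` equations in which `ψ_Ξ` is substituted, the
coordinate `x_j^{(q_j - p_r)}` has been replaced, so these equations have tight edges only to the
`|J| = |I|` variables `y_j`. Raising the dual variables of these equations and of `y` by `1` keeps
feasibility and lowers the objective by `1` (`augmentation_isDualFeasible`).
-/

set_option linter.unusedSectionVars false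

noncomputable section

namespace DAE

/-! ### Nonsingular matrices with differently indexed rows and columns -/

theorem nonsing_iff_forall_vecMul {A B : Type*} [Fintype A] [DecidableEq A] (M : Matrix A B ℝ)
    (e : A ≃ B) :
    Nonsing M ↔ ∀ a : A → ℝ, (∀ j, ∑ i, a i * M i j = 0) → a = 0 := by
  have key : ∀ f : A ≃ B, (M.submatrix id f).det ≠ 0 ↔
      ∀ a : A → ℝ, (∀ j, ∑ i, a i * M i j = 0) → a = 0 := by
    intro f
    rw [← not_iff_not, not_not, ← Matrix.exists_vecMul_eq_zero_iff]
    push Not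
    refine exists_congr fun a => ?_
    rw [and_comm]
    refine and_congr_left fun _ => ?_
    rw [funext_iff]
    exact ⟨fun h j => by simpa [Matrix.vecMul, dotProduct] using h (f.symm j),
      fun h j => by simpa [Matrix.vecMul, dotProduct] using h (f j)⟩
  exact ⟨fun ⟨f, hf⟩ => (key f).1 hf, fun h => ⟨e, (key e).2 h⟩⟩

theorem nonsing_iff_forall_mulVec {A B : Type*} [Fintype A] [DecidableEq A] [Fintype B]
    (M : Matrix A B ℝ) (e : A ≃ B) :
    Nonsing M ↔ ∀ w : B → ℝ, (∀ i, ∑ j, M i j * w j = 0) → w = 0 := by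
  have key : ∀ f : A ≃ B, (M.submatrix id f).det ≠ 0 ↔
      ∀ w : B → ℝ, (∀ i, ∑ j, M i j * w j = 0) → w = 0 := by
    intro f
    have hs : ∀ (w : B → ℝ) i, ∑ j, M i j * w j = ∑ k, M i (f k) * w (f k) := fun w i =>
      (f.sum_comp fun j => M i j * w j).symm
    rw [Ne, ← Matrix.exists_mulVec_eq_zero_iff, not_exists]
    constructor
    · intro h w hw
      by_contra hne
      refine h (w ∘ f) ⟨fun h0 => hne (funext fun j => ?_), funext fun i => ?_⟩
      · simpa using congrFun h0 (f.symm j)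
      · simpa [Matrix.mulVec, dotProduct, hs] using hw i
    · rintro h v ⟨hv, hv0⟩
      refine hv ?_
      have := h (v ∘ f.symm) fun i => by
        rw [hs]
        simpa [Matrix.mulVec, dotProduct] using congrFun hv0 i
      funext k
      simpa using congrFun this (f k)
  exact ⟨fun ⟨f, hf⟩ => (key f).1 hf, fun h => ⟨e, (key e).2 h⟩⟩

/-- If `M[I, J]` is nonsingular, but no `M[I ∪ {r}, J ∪ {j}]` is, then the row `r` is a linear
combination of the rows in `I`; so it annihilates all vectors that the rows in `I` annihilate. -/
theorem row_mulVec_eq_zero {R C : Type*} [DecidableEq R] [Fintype C] [DecidableEq C]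
    (M : Matrix R C ℝ) {I : Finset R} {J : Finset C} {r : R} (hr : r ∉ I) (hIJ : I.card = J.card)
    (hI : Nonsing (M.submatrix (fun i : I => (i : R)) (fun j : J => (j : C))))
    (hrI : ∀ j ∉ J, ¬ Nonsing (M.submatrix (fun i : (insert r I : Finset R) => (i : R))
      (fun j' : (insert j J : Finset C) => (j' : C))))
    {w : C → ℝ} (hw : ∀ i ∈ I, ∑ j, M i j * w j = 0) : ∑ j, M r j * w j = 0 := by
  have hI' := (nonsing_iff_forall_vecMul _ (Finset.equivOfCardEq hIJ)).1 hI
  -- the rows in `I` are independent on the columns in `J`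
  have indep : ∀ a : R → ℝ, (∀ j ∈ J, ∑ i ∈ I, a i * M i j = 0) → ∀ i ∈ I, a i = 0 := by
    intro a ha i hi
    have := hI' (fun i => a i) fun j => by
      exact (Finset.sum_coe_sort I (fun i => a i * M i j)).trans (ha j j.2)
    exact congrFun this ⟨i, hi⟩
  -- a relation between the rows for each extra column
  have rel : ∀ j ∉ J, ∃ a : R → ℝ, ∀ k ∈ insert j J, M r k = ∑ i ∈ I, a i * M i k := by
    intro j hj
    have hcard : (insert r I).card = (insert j J).card := by
      rw [Finset.card_insert_of_notMem hr, Finset.card_insert_of_notMem hj, hIJ]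
    have h := hrI j hj
    rw [nonsing_iff_forall_vecMul _ (Finset.equivOfCardEq hcard)] at h
    push Not at h
    obtain ⟨b, hb, hb0⟩ := h
    let a : R → ℝ := fun i => if h : i ∈ insert r I then b ⟨i, h⟩ else 0
    have ha : ∀ k ∈ insert j J, a r * M r k + ∑ i ∈ I, a i * M i k = 0 := by
      intro k hk
      rw [← Finset.sum_insert hr (f := fun i => a i * M i k), ← Finset.sum_coe_sort, ← hb ⟨k, hk⟩]
      exact Finset.sum_congr rfl fun i _ => by simp only [a, i.2, dif_pos]; rfl
    have har : a r ≠ 0 := by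
      intro har
      refine hb0 (funext fun i => ?_)
      have hz := indep a fun k hk => by
        simpa [har] using ha k (Finset.mem_insert_of_mem hk)
      have : a i = 0 := by
        rcases Finset.mem_insert.1 i.2 with h | h
        · rw [h, har]
        · exact hz _ h
      simp only [a, i.2, dif_pos] at this
      exact this
    refine ⟨fun i => -(a i) / a r, fun k hk => ?_⟩
    have h1 : ∑ i ∈ I, -(a i) / a r * M i k = -(∑ i ∈ I, a i * M i k) / a r := by
      rw [← Finset.sum_neg_distrib, Finset.sum_div]
      exact Finset.sum_congr rfl fun i _ => by ring
    rw [h1, eq_div_iff har]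
    linarith [ha k hk]
  -- the coefficients are determined by the columns in `J`, so they do not depend on the column
  obtain ⟨a, ha⟩ : ∃ a : R → ℝ, ∀ k, M r k = ∑ i ∈ I, a i * M i k := by
    by_cases hJ : ∃ j, j ∉ J
    · obtain ⟨j, hj⟩ := hJ
      obtain ⟨a, ha⟩ := rel j hj
      refine ⟨a, fun k => ?_⟩
      by_cases hk : k ∈ J
      · exact ha k (Finset.mem_insert_of_mem hk)
      · obtain ⟨b, hb⟩ := rel k hk
        have hab := indep (fun i => b i - a i) fun k hk => by
          simp only [sub_mul, Finset.sum_sub_distrib]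
          rw [← ha k (Finset.mem_insert_of_mem hk), ← hb k (Finset.mem_insert_of_mem hk), sub_self]
        rw [hb k (Finset.mem_insert_self _ _)]
        exact Finset.sum_congr rfl fun i hi => by rw [sub_eq_zero.1 (hab i hi)]
    · -- if `J` contains all columns, no relation is at hand: solve for the coefficients
      push Not at hJ
      obtain ⟨e, he⟩ := hI
      let A := M.submatrix (fun i : I => (i : R)) (fun i : I => ((e i : J) : C))
      have hA : IsUnit A.det := isUnit_iff_ne_zero.2 he
      let v : I → ℝ := fun i => M r (e i)
      have hv : Matrix.vecMul (Matrix.vecMul v A⁻¹) A = v := by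
        rw [Matrix.vecMul_vecMul, Matrix.nonsing_inv_mul _ hA, Matrix.vecMul_one]
      refine ⟨fun i => if h : i ∈ I then Matrix.vecMul v A⁻¹ ⟨i, h⟩ else 0, fun k => ?_⟩
      have := congrFun hv (e.symm ⟨k, hJ k⟩)
      simp only [v, Equiv.apply_symm_apply] at this
      rw [← this, ← Finset.sum_coe_sort I]
      simp [Matrix.vecMul, dotProduct, A, v]
  simp only [ha, Finset.sum_mul]
  rw [Finset.sum_comm]
  refine Finset.sum_eq_zero fun i hi => ?_
  simp only [mul_assoc]
  rw [← Finset.mul_sum, hw i hi, mul_zero]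

namespace System

variable {R C : Type*} [Fintype R] [DecidableEq R] [Fintype C] [DecidableEq C] {N : C → ℕ}
  (E : System R N)

/-! ### The dual problem -/

theorem DependsOn.le_ord {E : System R N} {i : R} {j : C} {k : Fin (N j + 1)}
    (h : E.DependsOn i ⟨j, k⟩) : (((k : ℕ) : ℕ) : WithBot ℕ) ≤ E.ord i j := by
  unfold ord
  refine le_trans ?_ (Finset.le_sup (Finset.mem_univ k))
  rw [if_pos h]

theorem exists_dependsOn_of_ord_eq {E : System R N} {i : R} {j : C} {c : ℕ}
    (h : E.ord i j = (c : WithBot ℕ)) :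
    ∃ k : Fin (N j + 1), (k : ℕ) = c ∧ E.DependsOn i ⟨j, k⟩ := by
  classical
  unfold ord at h
  obtain ⟨k, -, hk⟩ := Finset.exists_mem_eq_sup Finset.univ Finset.univ_nonempty
    (fun k : Fin (N j + 1) =>
      if E.DependsOn i ⟨j, k⟩ then (((k : ℕ) : ℕ) : WithBot ℕ) else ⊥)
  refine ⟨k, ?_⟩
  simp only [h] at hk
  split_ifs at hk with hd
  · exact ⟨(WithBot.coe_injective hk).symm, hd⟩
  · exact absurd hk (WithBot.coe_ne_bot)

theorem ord_le {E : System R N} {i : R} {j : C} {c : ℕ} (h : E.ord i j = (c : WithBot ℕ)) :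
    c ≤ N j := by
  obtain ⟨k, rfl, -⟩ := exists_dependsOn_of_ord_eq h
  exact Nat.lt_succ_iff.1 k.2

/-- Feasibility means that `F_i` depends on `x_j^{(k)}` only for `k ≤ q_j - p_i`. -/
theorem isDualFeasible_iff {E : System R N} {p : R → ℤ} {q : C → ℤ} :
    E.IsDualFeasible p q ↔
      ∀ i j, ∀ k : Fin (N j + 1), E.DependsOn i ⟨j, k⟩ → ((k : ℕ) : ℤ) ≤ q j - p i := by
  constructor
  · intro h i j k hk
    have hle := hk.le_ord
    obtain ⟨c, hc⟩ := WithBot.ne_bot_iff_exists.1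
      (ne_bot_of_le_ne_bot WithBot.coe_ne_bot hle)
    rw [← hc] at hle
    have h1 : (k : ℕ) ≤ c := WithBot.coe_le_coe.1 hle
    have h2 := h i j c hc.symm
    omega
  · intro h i j c hc
    obtain ⟨k, rfl, hk⟩ := exists_dependsOn_of_ord_eq hc
    exact h i j k hk

theorem dualValue_ite (p : R → ℤ) (q : C → ℤ) (A : Finset R) (B : Finset C) (u : ℤ) :
    dualValue (fun i => p i + if i ∈ A then u else 0) (fun j => q j + if j ∈ B then u else 0) =
      dualValue p q + u * (B.card - A.card) := by
  simp only [dualValue, Finset.sum_add_distrib, Finset.sum_ite_mem, Finset.univ_inter,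
    Finset.sum_const, nsmul_eq_mul]
  ring

variable {E}

/-- Complementary slackness. By Hall's theorem, the tight edges contain a perfect matching: for a set
of rows with too few tight neighbours, raising `p` on the set and `q` on its neighbours would improve
the objective. -/
theorem IsDualOptimal.exists_tight {p : R → ℤ} {q : C → ℤ} (h : E.IsDualOptimal p q)
    (hcard : Fintype.card R = Fintype.card C) :
    ∃ σ : R ≃ C, ∀ i, ∃ c : ℕ, E.ord i (σ i) = (c : WithBot ℕ) ∧ (c : ℤ) = q (σ i) - p i := by
  classical
  let tight : R → Finset C := fun i =>
    Finset.univ.filter fun j => ∃ c : ℕ, E.ord i j = (c : WithBot ℕ) ∧ (c : ℤ) = q j - p i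
  obtain ⟨f, hf, hft⟩ := (Finset.all_card_le_biUnion_card_iff_exists_injective tight).1 (by
    intro A
    by_contra hA
    push Not at hA
    have hfeas : E.IsDualFeasible (fun i => p i + if i ∈ A then 1 else 0)
        (fun j => q j + if j ∈ A.biUnion tight then 1 else 0) := by
      intro i j c hc
      have h0 := h.1 i j c hc
      by_cases hi : i ∈ A
      · by_cases hj : j ∈ A.biUnion tight
        · simp only [hi, hj, if_true]; omega
        · have hne : (c : ℤ) ≠ q j - p i := fun he => hj (Finset.mem_biUnion.2
            ⟨i, hi, Finset.mem_filter.2 ⟨Finset.mem_univ _, c, hc, he⟩⟩)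
          simp only [hi, hj, if_true, if_false]; omega
      · simp only [hi, if_false]; split_ifs <;> omega
    have := h.2 _ _ hfeas
    rw [dualValue_ite] at this
    omega)
  refine ⟨Equiv.ofBijective f ((Fintype.bijective_iff_injective_and_card f).2 ⟨hf, hcard⟩),
    fun i => ?_⟩
  simpa [tight] using hft i

theorem dualValue_nonneg (hM : E.HasPerfectMatching) {p : R → ℤ} {q : C → ℤ}
    (h : E.IsDualFeasible p q) : 0 ≤ dualValue p q := by
  obtain ⟨σ, hσ⟩ := hM
  rw [dualValue, ← σ.sum_comp, ← Finset.sum_sub_distrib]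
  refine Finset.sum_nonneg fun i _ => ?_
  obtain ⟨c, hc⟩ := WithBot.ne_bot_iff_exists.1 (hσ i)
  have := h i _ c hc.symm
  omega

theorem exists_isDualOptimal (hM : E.HasPerfectMatching) :
    ∃ (p : R → ℤ) (q : C → ℤ), E.IsDualOptimal p q := by
  obtain ⟨⟨p, q⟩, hpq⟩ := exists_minimalFor_of_wellFoundedLT
    (fun pq : (R → ℤ) × (C → ℤ) => E.IsDualFeasible pq.1 pq.2)
    (fun pq => (dualValue pq.1 pq.2).toNat)
    ⟨(fun _ => 0, fun j => N j), fun i j c hc => by simpa using ord_le hc⟩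
  refine ⟨p, q, hpq.1, fun p' q' h' => ?_⟩
  have h1 := hpq.le (j := (p', q')) h'
  have h2 := dualValue_nonneg hM h'
  simp only at h1
  omega

/-- Among the optimal solutions with `p ≥ 0`, one with minimal `∑ p_i` has no gap larger than the
maximal order between consecutive values of `p`: otherwise one could lower by `1` the `p_i` above the
gap and the `q_j` of the variables matched with them. -/
theorem exists_isDualOptimal_noGap {l : ℕ} (hl : ∀ j, N j ≤ l) (hM : E.HasPerfectMatching) :
    ∃ (p : R → ℤ) (q : C → ℤ), E.IsDualOptimal p q ∧ (∀ i, 0 ≤ p i) ∧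
      ∀ i, 0 < p i → ∃ i', p i' < p i ∧ p i - l ≤ p i' := by
  classical
  have hcard : Fintype.card R = Fintype.card C := Fintype.card_congr hM.choose
  have hex : ∃ pq : (R → ℤ) × (C → ℤ), E.IsDualOptimal pq.1 pq.2 ∧ ∀ i, 0 ≤ pq.1 i := by
    obtain ⟨p, q, h⟩ := exists_isDualOptimal hM
    let u : ℤ := ∑ i, |p i|
    -- adding a constant to all dual variables changes neither feasibility nor the objective
    refine ⟨(fun i => p i + u, fun j => q j + u), ⟨fun i j c hc => ?_, fun p' q' h' => ?_⟩,
      fun i => ?_⟩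
    · have := h.1 i j c hc
      simp only
      omega
    · have := dualValue_ite p q Finset.univ Finset.univ u
      simp only [Finset.mem_univ, if_true, Finset.card_univ, hcard, sub_self, mul_zero,
        add_zero] at this
      rw [this]
      exact h.2 p' q' h'
    · have h1 : |p i| ≤ u :=
        Finset.single_le_sum (f := fun i => |p i|) (fun i _ => abs_nonneg _) (Finset.mem_univ i)
      have h2 := neg_abs_le (p i)
      simp only
      omega
  obtain ⟨⟨p, q⟩, hmin⟩ := exists_minimalFor_of_wellFoundedLT
    (fun pq : (R → ℤ) × (C → ℤ) => E.IsDualOptimal pq.1 pq.2 ∧ ∀ i, 0 ≤ pq.1 i)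
    (fun pq => (∑ i, pq.1 i).toNat) hex
  have hopt : E.IsDualOptimal p q := hmin.1.1
  have hp : ∀ i, 0 ≤ p i := hmin.1.2
  refine ⟨p, q, hopt, hp, fun i₀ hi₀ => ?_⟩
  by_contra hgap
  push Not at hgap
  obtain ⟨σ, hσ⟩ := hopt.exists_tight hcard
  -- the rows above the gap and the columns matched with them
  let A : Finset R := Finset.univ.filter fun i => p i₀ ≤ p i
  let B : Finset C := A.map σ.toEmbedding
  have hval : dualValue (fun i => p i + if i ∈ A then -1 else 0)
      (fun j => q j + if j ∈ B then -1 else 0) = dualValue p q := by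
    rw [dualValue_ite, Finset.card_map]
    ring
  have hfeas : E.IsDualFeasible (fun i => p i + if i ∈ A then -1 else 0)
      (fun j => q j + if j ∈ B then -1 else 0) := by
    intro i j c hc
    have h0 := hopt.1 i j c hc
    by_cases hj : j ∈ B
    · by_cases hi : i ∈ A
      · simp only [hi, hj, if_true]; omega
      · obtain ⟨i', hi', rfl⟩ := Finset.mem_map.1 hj
        obtain ⟨c', -, hc'⟩ := hσ i'
        have h1 : p i < p i₀ := by simpa [A] using hi
        have h2 := hgap i h1
        have h3 : p i₀ ≤ p i' := by simpa [A] using hi'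
        have h4 := ord_le hc
        have h5 := hl (σ i')
        simp only [Equiv.coe_toEmbedding] at h0 h4 hj ⊢
        simp only [hi, hj, if_true, if_false]
        omega
    · simp only [hj, if_false]; split_ifs <;> omega
  have hle := hmin.le (j := (_, _))
    ⟨⟨hfeas, fun p' q' h' => hval.trans_le (hopt.2 p' q' h')⟩, fun i => ?_⟩
  · have h1 : ∑ i, (p i + if i ∈ A then (-1 : ℤ) else 0) = ∑ i, p i - A.card := by
      simp [Finset.sum_add_distrib, Finset.sum_ite_mem, sub_eq_add_neg]
    have h2 : 0 < A.card := Finset.card_pos.2 ⟨i₀, by simp [A]⟩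
    have h3 : 0 < ∑ i, p i :=
      lt_of_lt_of_le hi₀ (Finset.single_le_sum (fun i _ => hp i) (Finset.mem_univ i₀))
    simp only [h1] at hle
    omega
  · have := hp i
    by_cases hi : i ∈ A
    · have h1 : p i₀ ≤ p i := by simpa [A] using hi
      simp only [hi, if_true]; omega
    · simp only [hi, if_false]; omega

theorem exists_isDualOptimal_bounded {l n : ℕ} (hl : ∀ j, N j ≤ l) (hR : Fintype.card R = n)
    (hM : E.HasPerfectMatching) :
    ∃ (p : R → ℤ) (q : C → ℤ), E.IsDualOptimal p q ∧
      (∀ i, 0 ≤ p i ∧ p i ≤ n * l) ∧ (∀ j, 0 ≤ q j ∧ q j ≤ n * l) := by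
  classical
  obtain ⟨p, q, hopt, hp, hgap⟩ := exists_isDualOptimal_noGap hl hM
  let low : R → Finset R := fun i => Finset.univ.filter fun i' => p i' < p i
  -- going down in steps of at most `l`, each step leaves fewer rows below
  have hlow : ∀ (k : ℕ) (i : R), (low i).card = k → p i ≤ k * l := by
    intro k
    induction k using Nat.strong_induction_on with
    | _ k ih =>
      intro i hi
      rcases (hp i).eq_or_lt with h0 | h0
      · rw [← h0]; positivity
      · obtain ⟨i', h1, h2⟩ := hgap i h0
        have hlt : (low i').card < k := by
          rw [← hi]
          refine Finset.card_lt_card (Finset.ssubset_iff_of_subset ?_ |>.2 ⟨i', ?_, ?_⟩)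
          · intro a ha
            simp only [low, Finset.mem_filter, Finset.mem_univ, true_and] at ha ⊢
            omega
          · simpa [low] using h1
          · simp [low]
        have h3 := ih _ hlt i' rfl
        have h4 : ((low i').card : ℤ) * l + l ≤ k * l := by
          have : ((low i').card : ℤ) + 1 ≤ k := by exact_mod_cast hlt
          nlinarith
        omega
  have hp' : ∀ i, p i + l ≤ n * l := by
    intro i
    have h1 := hlow _ i rfl
    have h2 : (low i).card < n := by
      rw [← hR, ← Finset.card_univ]
      refine Finset.card_lt_card (Finset.ssubset_univ_iff.2 fun h => ?_)
      have : i ∈ low i := h ▸ Finset.mem_univ i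
      simp [low] at this
    have h3 : ((low i).card : ℤ) + 1 ≤ n := by exact_mod_cast h2
    nlinarith
  obtain ⟨σ, hσ⟩ := hopt.exists_tight (Fintype.card_congr hM.choose)
  refine ⟨p, q, hopt, fun i => ⟨hp i, by have := hp' i; omega⟩, fun j => ?_⟩
  obtain ⟨i, rfl⟩ := σ.surjective j
  obtain ⟨c, hc, hcq⟩ := hσ i
  have h1 := ord_le hc
  have h2 := hl (σ i)
  have h3 := hp i
  have h4 := hp' i
  constructor <;> omega

theorem IsDualOptimal.deltaHat_eq {p : R → ℤ} {q : C → ℤ} (h : E.IsDualOptimal p q) :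
    E.deltaHat = ((dualValue p q : ℤ) : WithBot ℤ) := by
  have hex : ∃ pq : (R → ℤ) × (C → ℤ), E.IsDualOptimal pq.1 pq.2 := ⟨(p, q), h⟩
  rw [deltaHat, dif_pos hex]
  exact congrArg _ (le_antisymm (hex.choose_spec.2 _ _ h.1) (h.2 _ _ hex.choose_spec.1))

theorem IsDualFeasible.deltaHat_le {p : R → ℤ} {q : C → ℤ} (h : E.IsDualFeasible p q) :
    E.deltaHat ≤ ((dualValue p q : ℤ) : WithBot ℤ) := by
  rw [deltaHat]
  split_ifs with hex
  · exact WithBot.coe_le_coe.2 (hex.choose_spec.2 _ _ h)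
  · exact bot_le

/-! ### Existence of an admissible triple -/

/-- The set `I ∪ {r}` is a minimal set of rows that are generically dependent, and `r` is a row of
this set with minimal `p_r`. -/
theorem exists_isAdmissible {p : R → ℤ} {q : C → ℤ} (hne : (E.time ×ˢ E.dom).Nonempty)
    (hcard : Fintype.card R = Fintype.card C) (hsing : E.JacobianIdenticallySingular p q) :
    ∃ (r : R) (I : Finset R) (J : Finset C), E.IsAdmissible p q r I J := by
  classical
  obtain ⟨A, hA⟩ := exists_minimalFor_of_wellFoundedLT
    (fun A : Finset R => ∀ B : Finset C, B.card = A.card → ¬ E.NotIdenticallySingular p q A B)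
    Finset.card ⟨Finset.univ, by
      rintro B hB ⟨z, hz, e, he⟩
      rw [Finset.card_univ, hcard] at hB
      obtain rfl := Finset.card_eq_iff_eq_univ B |>.1 hB
      let eR : (Finset.univ : Finset R) ≃ R := Equiv.subtypeUnivEquiv Finset.mem_univ
      let eC : (Finset.univ : Finset C) ≃ C := Equiv.subtypeUnivEquiv Finset.mem_univ
      refine hsing z hz ⟨(eR.symm.trans e).trans eC, fun h0 => he ?_⟩
      rw [← h0, ← Matrix.det_submatrix_equiv_self eR]
      congr 1⟩
  have hAne : A.Nonempty := by
    rw [Finset.nonempty_iff_ne_empty]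
    rintro rfl
    obtain ⟨z, hz⟩ := hne
    exact hA.1 ∅ rfl ⟨z, hz, Equiv.equivOfIsEmpty _ _, by simp⟩
  obtain ⟨r, hr, hrmin⟩ := A.exists_min_image p hAne
  have hcardI : (A.erase r).card + 1 = A.card := Finset.card_erase_add_one hr
  obtain ⟨J, hJ, hJns⟩ : ∃ J : Finset C, J.card = (A.erase r).card ∧
      E.NotIdenticallySingular p q (A.erase r) J := by
    by_contra h
    push Not at h
    have := hA.le (j := A.erase r) h
    omega
  refine ⟨r, A.erase r, J, Finset.notMem_erase r A, hJ.symm, hJns, ⟨?_, ?_⟩,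
    fun i hi => hrmin i (Finset.mem_of_mem_erase hi)⟩
  · exact ⟨A.erase r, J, Finset.subset_insert _ _, rfl, hJ, hJns⟩
  · rintro m ⟨A', B, hA', hm, hB, hns⟩
    rw [Finset.insert_erase hr] at hA'
    by_contra hlt
    have hAA : A' = A := Finset.eq_of_subset_of_card_le hA' (by omega)
    subst hAA
    exact hA.1 B (by omega) hns

end System

/-! ### Jets and their coordinate directions -/

namespace Jet

variable {C : Type*} [Fintype C]

/-- `Jet.restrict` as a continuous linear map. -/
def restrictL {N M : C → ℕ} (h : ∀ j, N j ≤ M j) : Jet M →L[ℝ] Jet N :=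
  ContinuousLinearMap.pi fun c =>
    ContinuousLinearMap.proj (⟨c.1, Fin.castLE (Nat.succ_le_succ (h c.1)) c.2⟩ : Coord M)

@[simp]
theorem restrictL_apply {N M : C → ℕ} (h : ∀ j, N j ≤ M j) (X : Jet M) :
    restrictL h X = restrict h X := rfl

/-- `Jet.shift` as a continuous linear map. -/
def shiftL (N : C → ℕ) : Jet (fun j => N j + 1) →L[ℝ] Jet N :=
  ContinuousLinearMap.pi fun c =>
    ContinuousLinearMap.proj (⟨c.1, c.2.succ⟩ : Coord fun j => N j + 1)

@[simp]
theorem shiftL_apply {N : C → ℕ} (X : Jet (fun j => N j + 1)) : shiftL N X = shift X := rfl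

/-- The unit vector in the direction of the coordinate `x_j^{(k)}`. The order `k` may be any integer;
the vector is `0` if there is no such coordinate. With this convention, `restrict` and `shift` act on
these vectors without any case distinction. -/
def unitDir [DecidableEq C] (N : C → ℕ) (j : C) (k : ℤ) : Jet N :=
  fun c => if c.1 = j ∧ ((c.2 : ℕ) : ℤ) = k then 1 else 0

variable [DecidableEq C]

theorem restrict_unitDir {N M : C → ℕ} (h : ∀ j, N j ≤ M j) (j : C) (k : ℤ) :
    restrict h (unitDir M j k) = unitDir N j k := rfl

theorem shift_unitDir (N : C → ℕ) (j : C) (k : ℤ) :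
    shift (unitDir (fun j => N j + 1) j k) = unitDir N j (k - 1) := by
  funext c
  simp only [shift, unitDir, Fin.val_succ, Nat.cast_add, Nat.cast_one, eq_sub_iff_add_eq]

theorem unitDir_coe (N : C → ℕ) (j : C) (k : Fin (N j + 1)) :
    unitDir N j ((k : ℕ) : ℤ) = Pi.single (⟨j, k⟩ : Coord N) 1 := by
  funext c
  obtain ⟨j', k'⟩ := c
  by_cases hj : j' = j
  · subst hj
    simp [unitDir, Fin.ext_iff, Pi.single_apply]
  · simp [unitDir, hj]

theorem unitDir_eq_zero (N : C → ℕ) (j : C) (k : ℤ) (h : ∀ k' : Fin (N j + 1), ((k' : ℕ) : ℤ) ≠ k) :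
    unitDir N j k = 0 := by
  funext c
  refine if_neg ?_
  rintro ⟨rfl, hk⟩
  exact h _ hk

end Jet

open Jet
open scoped Topology ContDiff

section Calculus

variable {C : Type*} [Fintype C] [DecidableEq C] {N : C → ℕ}

/-- The partial derivative `∂f/∂x_j^{(k)}` for an integer `k`, which is `0` if `x_j^{(k)}` is not an
argument of `f`. -/
def coordDeriv (f : ℝ × Jet N → ℝ) (j : C) (k : ℤ) (z : ℝ × Jet N) : ℝ :=
  fderiv ℝ f z (0, unitDir N j k)

theorem coordDeriv_coe (f : ℝ × Jet N → ℝ) (j : C) (k : Fin (N j + 1)) :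
    coordDeriv f j ((k : ℕ) : ℤ) = pderiv f ⟨j, k⟩ := by
  funext z
  rw [coordDeriv, pderiv, unitDir_coe]

theorem coordDeriv_eq_zero (f : ℝ × Jet N → ℝ) (j : C) (k : ℤ)
    (h : ∀ k' : Fin (N j + 1), ((k' : ℕ) : ℤ) ≠ k) (z : ℝ × Jet N) : coordDeriv f j k z = 0 := by
  rw [coordDeriv, unitDir_eq_zero N j k h, Prod.mk_zero_zero, map_zero]

theorem coordDeriv_eq_sum (f : ℝ × Jet N → ℝ) (j : C) (k : ℤ) (z : ℝ × Jet N) :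
    coordDeriv f j k z =
      ∑ k' : Fin (N j + 1), if ((k' : ℕ) : ℤ) = k then pderiv f ⟨j, k'⟩ z else 0 := by
  by_cases h : ∃ k' : Fin (N j + 1), ((k' : ℕ) : ℤ) = k
  · obtain ⟨k', rfl⟩ := h
    rw [coordDeriv_coe, Finset.sum_eq_single k']
    · simp
    · intro b _ hb
      rw [if_neg]
      exact fun h => hb (Fin.ext (by exact_mod_cast h))
    · simp
  · push Not at h
    rw [coordDeriv_eq_zero f j k h, Finset.sum_eq_zero fun k' _ => if_neg (h k')]

/-! ### Formal derivatives -/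

variable {T : Set ℝ} {Ω : Set (Jet N)} {f : ℝ × Jet N → ℝ}

theorem analyticAt_totalDeriv {z : ℝ × Jet (fun j => N j + 1)}
    (hf : AnalyticAt ℝ f (z.1, restrict (fun j => Nat.le_succ (N j)) z.2)) :
    AnalyticAt ℝ (totalDeriv f) z := by
  refine ContDiffAt.analyticAt ?_
  have h : ContDiffAt ℝ ω (fderiv ℝ f) (z.1, restrict (fun j => Nat.le_succ (N j)) z.2) :=
    hf.fderiv.contDiffAt
  have hA : ContDiffAt ℝ ω (fun z : ℝ × Jet (fun j => N j + 1) =>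
      (z.1, restrict (fun j => Nat.le_succ (N j)) z.2)) z :=
    contDiffAt_fst.prodMk ((restrictL fun j => Nat.le_succ (N j)).contDiff.contDiffAt.comp z
      contDiffAt_snd)
  have hB : ContDiffAt ℝ ω (fun z : ℝ × Jet (fun j => N j + 1) => ((1 : ℝ), shift z.2)) z :=
    contDiffAt_const.prodMk ((shiftL N).contDiff.contDiffAt.comp z contDiffAt_snd)
  exact (h.comp z hA).clm_apply hB

theorem analyticOnNhd_iterDeriv (hf : AnalyticOnNhd ℝ f (T ×ˢ Ω)) (d : ℕ) :
    AnalyticOnNhd ℝ (iterDeriv f d)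
      (T ×ˢ (restrict (fun j => Nat.le_add_right (N j) d) ⁻¹' Ω)) := by
  induction d with
  | zero => exact hf
  | succ d ih => exact fun z hz => analyticAt_totalDeriv (ih _ hz)

/-- Differentiating the definition of `ḟ` gives
`∂ḟ/∂x_j^{(k)} = (∂f/∂x_j^{(k)})˙ + ∂f/∂x_j^{(k-1)}`, by the symmetry of second derivatives. -/
theorem coordDeriv_totalDeriv {z : ℝ × Jet (fun j => N j + 1)}
    (hf : AnalyticAt ℝ f (z.1, restrict (fun j => Nat.le_succ (N j)) z.2)) (j : C) (k : ℤ) :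
    coordDeriv (totalDeriv f) j k z = totalDeriv (coordDeriv f j k) z +
      coordDeriv f j (k - 1) (z.1, restrict (fun j => Nat.le_succ (N j)) z.2) := by
  set a : ℝ × Jet N := (z.1, restrict (fun j => Nat.le_succ (N j)) z.2) with ha
  have h1 : HasFDerivAt (fderiv ℝ f) (fderiv ℝ (fderiv ℝ f) a) a :=
    hf.fderiv.differentiableAt.hasFDerivAt
  have hsymm : IsSymmSndFDerivAt ℝ f a :=
    (hf.contDiffAt (n := 2)).isSymmSndFDerivAt (by simp)
  have hA : HasFDerivAt (fun z : ℝ × Jet (fun j => N j + 1) =>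
      (z.1, restrict (fun j => Nat.le_succ (N j)) z.2)) _ z :=
    hasFDerivAt_fst.prodMk ((restrictL fun j => Nat.le_succ (N j)).hasFDerivAt.comp z
      hasFDerivAt_snd)
  have hB : HasFDerivAt (fun z : ℝ × Jet (fun j => N j + 1) => ((1 : ℝ), shift z.2)) _ z :=
    (hasFDerivAt_const _ _).prodMk ((shiftL N).hasFDerivAt.comp z hasFDerivAt_snd)
  have h3 : HasFDerivAt (totalDeriv f) _ z := (h1.comp z hA).clm_apply hB
  have h4 : HasFDerivAt (coordDeriv f j k)
      ((fderiv ℝ (fderiv ℝ f) a).flip (0, unitDir N j k)) a := by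
    have := h1.clm_apply (hasFDerivAt_const ((0, unitDir N j k) : ℝ × Jet N) a)
    simpa [coordDeriv] using! this
  have h5 : totalDeriv (coordDeriv f j k) z =
      fderiv ℝ (fderiv ℝ f) a (1, shift z.2) (0, unitDir N j k) := by
    rw [totalDeriv, h4.fderiv, ContinuousLinearMap.flip_apply]
  rw [h5, coordDeriv, h3.fderiv, hsymm.eq (1, shift z.2)]
  simp [coordDeriv, restrict_unitDir, shift_unitDir, add_comm, ha]

theorem totalDeriv_eq_zero (hT : IsOpen T) (hΩ : IsOpen Ω) (h0 : ∀ z ∈ T ×ˢ Ω, f z = 0)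
    {z : ℝ × Jet (fun j => N j + 1)}
    (hz : (z.1, restrict (fun j => Nat.le_succ (N j)) z.2) ∈ T ×ˢ Ω) : totalDeriv f z = 0 := by
  have h : f =ᶠ[nhds (z.1, restrict (fun j => Nat.le_succ (N j)) z.2)] fun _ => 0 :=
    Filter.eventually_of_mem ((hT.prod hΩ).mem_nhds hz) h0
  rw [totalDeriv, h.fderiv_eq]
  simp

/-- If `f` depends on `x_j^{(k)}` only for `k ≤ e`, then `f^{(d)}` depends on it only for `k ≤ e + d`,
and `∂f^{(d)}/∂x_j^{(e+d)} = ∂f/∂x_j^{(e)}`. -/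
theorem coordDeriv_iterDeriv (hT : IsOpen T) (hΩ : IsOpen Ω) (hf : AnalyticOnNhd ℝ f (T ×ˢ Ω))
    (j : C) (e : ℤ) (he : ∀ k > e, ∀ z ∈ T ×ˢ Ω, coordDeriv f j k z = 0) (d : ℕ) :
    (∀ k > e + d, ∀ z ∈ T ×ˢ (restrict (fun j => Nat.le_add_right (N j) d) ⁻¹' Ω),
      coordDeriv (iterDeriv f d) j k z = 0) ∧
    ∀ z ∈ T ×ˢ (restrict (fun j => Nat.le_add_right (N j) d) ⁻¹' Ω),
      coordDeriv (iterDeriv f d) j (e + d) z =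
        coordDeriv f j e (z.1, restrict (fun j => Nat.le_add_right (N j) d) z.2) := by
  induction d with
  | zero =>
    refine ⟨fun k hk z hz => he k (by simpa using hk) z hz, fun z _ => ?_⟩
    rw [Nat.cast_zero, add_zero]
    rfl
  | succ d ih =>
    have hΩd : IsOpen (restrict (fun j => Nat.le_add_right (N j) d) ⁻¹' Ω) :=
      hΩ.preimage (restrictL fun j => Nat.le_add_right (N j) d).continuous
    have step : ∀ k > e + d,
        ∀ z ∈ T ×ˢ (restrict (fun j => Nat.le_add_right (N j) (d + 1)) ⁻¹' Ω),
        coordDeriv (iterDeriv f (d + 1)) j k z = coordDeriv (iterDeriv f d) j (k - 1)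
          (z.1, restrict (fun j => Nat.le_succ (N j + d)) z.2) := by
      intro k hk z hz
      have := coordDeriv_totalDeriv (f := iterDeriv f d) (z := z)
        (analyticOnNhd_iterDeriv hf d _ hz) j k
      rw [totalDeriv_eq_zero hT hΩd (ih.1 k hk) hz, zero_add] at this
      exact this
    refine ⟨fun k hk z hz => ?_, fun z hz => ?_⟩
    · push_cast at hk
      rw [step k (by omega) z hz]
      exact ih.1 _ (by omega) _ hz
    · push_cast
      rw [step _ (by omega) z hz, show e + ((d : ℤ) + 1) - 1 = e + d by ring]
      exact ih.2 _ hz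

/-! ### Derivatives along trajectories -/

theorem contDiffOn_iteratedDeriv {g : ℝ → ℝ} {S : Set ℝ} (hS : IsOpen S) {n : WithTop ℕ∞}
    (hg : ContDiffOn ℝ n g S) {m : WithTop ℕ∞} {k : ℕ} (h : m + k ≤ n) :
    ContDiffOn ℝ m (iteratedDeriv k g) S := by
  induction k generalizing m with
  | zero => simpa using hg.of_le (by simpa using h)
  | succ k ih =>
    rw [iteratedDeriv_succ]
    refine (ih (m := m + 1) ?_).deriv_of_isOpen hS le_rfl
    rw [add_assoc, add_comm (1 : WithTop ℕ∞)]
    exact_mod_cast h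

theorem contDiffOn_ofTrajectory {x : ℝ → C → ℝ} {S : Set ℝ} (hS : IsOpen S) {s : WithTop ℕ∞}
    (hx : ∀ j, ContDiffOn ℝ (s + N j) (fun t => x t j) S) :
    ContDiffOn ℝ s (ofTrajectory N x) S := by
  refine contDiffOn_pi.2 fun c => contDiffOn_iteratedDeriv hS (hx c.1) ?_
  gcongr
  exact Nat.lt_succ_iff.1 c.2.2

theorem hasDerivAt_ofTrajectory {x : ℝ → C → ℝ} {S : Set ℝ} (hS : IsOpen S)
    (hx : ∀ j, ContDiffOn ℝ (N j + 1 : ℕ) (fun t => x t j) S) {t : ℝ} (ht : t ∈ S) :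
    HasDerivAt (ofTrajectory N x) (shift (ofTrajectory (fun j => N j + 1) x t)) t := by
  refine hasDerivAt_pi.2 fun c => ?_
  have h : ContDiffOn ℝ 1 (iteratedDeriv c.2 fun s => x s c.1) S :=
    contDiffOn_iteratedDeriv hS (hx c.1) (by
      have := c.2.2
      exact_mod_cast (by omega : 1 + (c.2 : ℕ) ≤ N c.1 + 1))
  have h' := ((h.contDiffAt (hS.mem_nhds ht)).differentiableAt (by simp)).hasDerivAt
  rw [← iteratedDeriv_succ] at h'
  exact h'

/-- The chain rule that motivates the definition of `ḟ`. -/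
theorem hasDerivAt_comp_ofTrajectory {x : ℝ → C → ℝ} {S : Set ℝ} (hS : IsOpen S)
    (hx : ∀ j, ContDiffOn ℝ (N j + 1 : ℕ) (fun t => x t j) S) {t : ℝ} (ht : t ∈ S)
    (hf : AnalyticAt ℝ f (t, ofTrajectory N x t)) :
    HasDerivAt (fun τ => f (τ, ofTrajectory N x τ))
      (totalDeriv f (t, ofTrajectory (fun j => N j + 1) x t)) t :=
  HasFDerivAt.comp_hasDerivAt (f := fun τ => (τ, ofTrajectory N x τ)) t
    hf.differentiableAt.hasFDerivAt ((hasDerivAt_id t).prodMk (hasDerivAt_ofTrajectory hS hx ht))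

theorem iterDeriv_ofTrajectory_eq_zero {x : ℝ → C → ℝ} {S : Set ℝ} (hS : IsOpen S) (hST : S ⊆ T)
    (hf : AnalyticOnNhd ℝ f (T ×ˢ Ω)) (hΩ : ∀ t ∈ S, ofTrajectory N x t ∈ Ω)
    (h0 : ∀ t ∈ S, f (t, ofTrajectory N x t) = 0) (d : ℕ)
    (hx : ∀ j, ContDiffOn ℝ (N j + d : ℕ) (fun t => x t j) S) :
    ∀ t ∈ S, iterDeriv f d (t, ofTrajectory (fun j => N j + d) x t) = 0 := by
  induction d with
  | zero => exact h0
  | succ d ih =>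
    intro t ht
    have ih' := ih fun j => (hx j).of_le (by exact_mod_cast Nat.le_succ _)
    have h := hasDerivAt_comp_ofTrajectory (N := fun j => N j + d) (f := iterDeriv f d) hS hx ht
      (analyticOnNhd_iterDeriv hf d _ ⟨hST ht, hΩ t ht⟩)
    have h2 : (fun τ => iterDeriv f d (τ, ofTrajectory (fun j => N j + d) x τ)) =ᶠ[nhds t]
        fun _ => 0 := Filter.eventually_of_mem (hS.mem_nhds ht) ih'
    exact h.unique ((hasDerivAt_const t 0).congr_of_eventuallyEq h2)

end Calculus

/-! ### Directions in the space of jets -/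

section Directions

variable {C : Type*} [Fintype C] [DecidableEq C]

theorem coordDeriv_comp_restrict {N M : C → ℕ} (h : ∀ j, N j ≤ M j) {f : ℝ × Jet N → ℝ}
    {z : ℝ × Jet M} (hf : DifferentiableAt ℝ f (z.1, restrict h z.2)) (j : C) (k : ℤ) :
    coordDeriv (fun z : ℝ × Jet M => f (z.1, restrict h z.2)) j k z =
      coordDeriv f j k (z.1, restrict h z.2) := by
  have hA : HasFDerivAt (fun z : ℝ × Jet M => (z.1, restrict h z.2)) _ z :=
    hasFDerivAt_fst.prodMk ((restrictL h).hasFDerivAt.comp z hasFDerivAt_snd)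
  have h1 : HasFDerivAt (fun z : ℝ × Jet M => f (z.1, restrict h z.2)) _ z :=
    HasFDerivAt.comp z hf.hasFDerivAt hA
  rw [coordDeriv, h1.fderiv]
  simp [coordDeriv, restrict_unitDir]

/-- The direction in which each coordinate `x_j^{(o_j)}` changes with speed `w_j`. -/
def orderDir (N : C → ℕ) (o : C → ℤ) (w : C → ℝ) : Jet N :=
  fun c => if ((c.2 : ℕ) : ℤ) = o c.1 then w c.1 else 0

theorem fderiv_orderDir {N : C → ℕ} (f : ℝ × Jet N → ℝ) (o : C → ℤ) (w : C → ℝ) (z : ℝ × Jet N) :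
    fderiv ℝ f z (0, orderDir N o w) = ∑ j, coordDeriv f j (o j) z * w j := by
  have h : ((0 : ℝ), orderDir N o w) = ∑ j, w j • ((0 : ℝ), unitDir N j (o j)) := by
    refine Prod.ext (by simp [Prod.fst_sum]) ?_
    funext c
    simp only [orderDir, unitDir, Prod.snd_sum, Prod.smul_snd, Finset.sum_apply, Pi.smul_apply,
      smul_eq_mul]
    rw [Finset.sum_eq_single c.1]
    · simp
    · intro j _ hj
      simp [hj.symm]
    · simp
  rw [h, map_sum]
  refine Finset.sum_congr rfl fun j _ => ?_
  rw [map_smul, smul_eq_mul, mul_comm, coordDeriv]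

end Directions

namespace System

variable {R C : Type*} [Fintype R] [DecidableEq R] [Fintype C] [DecidableEq C]

section General

variable {N : C → ℕ} {E : System R N} {p : R → ℤ} {q : C → ℤ}

theorem jacobian_apply (z : ℝ × Jet N) (i : R) (j : C) :
    E.jacobian p q z i j = coordDeriv (E.eqn i) j (q j - p i) z := by
  rw [coordDeriv_eq_sum]
  rfl

theorem IsDualFeasible.coordDeriv_eq_zero (h : E.IsDualFeasible p q) {i : R} {j : C} {k : ℤ}
    (hk : q j - p i < k) {z : ℝ × Jet N} (hz : z ∈ E.time ×ˢ E.dom) :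
    coordDeriv (E.eqn i) j k z = 0 := by
  by_cases hk' : ∃ k' : Fin (N j + 1), ((k' : ℕ) : ℤ) = k
  · obtain ⟨k', rfl⟩ := hk'
    rw [coordDeriv_coe]
    by_contra hne
    exact absurd (isDualFeasible_iff.1 h i j k' ⟨z, hz, hne⟩) (not_le.2 hk)
  · push Not at hk'
    exact DAE.coordDeriv_eq_zero _ _ _ hk' _

end General

section Method

variable {l : ℕ} {E : System R (fun _ : C => l)} {p : R → ℤ} {q : C → ℤ} {r : R} {I : Finset R}
  {J : Finset C}

/-! ### The differentiated equations -/

theorem isOpen_extDom (hE : E.IsRealAnalytic) : IsOpen (E.extDom p r I) :=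
  hE.2.2.2.1.preimage (restrictL fun _ => Nat.le_add_right l _).continuous

theorem analyticAt_comp_restrict {N M : C → ℕ} (h : ∀ j, N j ≤ M j) {f : ℝ × Jet N → ℝ}
    {z : ℝ × Jet M} (hf : AnalyticAt ℝ f (z.1, restrict h z.2)) :
    AnalyticAt ℝ (fun z : ℝ × Jet M => f (z.1, restrict h z.2)) z :=
  AnalyticAt.fun_comp (f := fun z : ℝ × Jet M => (z.1, restrict h z.2)) hf
    (analyticAt_fst.prod (((restrictL h).analyticAt _).comp analyticAt_snd))

theorem analyticAt_diffEqn (hE : E.IsRealAnalytic) (i : I) {z : ℝ × ExtJet C l p r I}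
    (hz : z ∈ E.time ×ˢ E.extDom p r I) : AnalyticAt ℝ (E.diffEqn p r I i) z :=
  analyticAt_comp_restrict (fun _ => Nat.add_le_add_left (toNat_le_kappa p r I i) l)
    (analyticOnNhd_iterDeriv (hE.2.2.2.2.2 i) (p i - p r).toNat (z.1, _) ⟨hz.1, hz.2⟩)

/-- `F_i` as a function of `(t, x, …, x^{(l + κ)})`. -/
def extEqn (E : System R (fun _ : C => l)) (p : R → ℤ) (r : R) (I : Finset R) (i : R)
    (z : ℝ × ExtJet C l p r I) : ℝ :=
  E.eqn i (z.1, Jet.restrict (fun _ => Nat.le_add_right l _) z.2)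

theorem analyticAt_extEqn (hE : E.IsRealAnalytic) (i : R) {z : ℝ × ExtJet C l p r I}
    (hz : z ∈ E.time ×ˢ E.extDom p r I) : AnalyticAt ℝ (E.extEqn p r I i) z :=
  analyticAt_comp_restrict (fun _ => Nat.le_add_right l _) (hE.2.2.2.2.2 i (z.1, _) ⟨hz.1, hz.2⟩)

theorem coordDeriv_extEqn (hE : E.IsRealAnalytic) (i : R) {z : ℝ × ExtJet C l p r I}
    (hz : z ∈ E.time ×ˢ E.extDom p r I) (j : C) (k : ℤ) :
    coordDeriv (E.extEqn p r I i) j k z =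
      coordDeriv (E.eqn i) j k (z.1, Jet.restrict (fun _ => Nat.le_add_right l _) z.2) :=
  coordDeriv_comp_restrict (fun _ => Nat.le_add_right l _)
    (hE.2.2.2.2.2 i (z.1, _) ⟨hz.1, hz.2⟩).differentiableAt _ _

theorem coordDeriv_diffEqn (hE : E.IsRealAnalytic) (hpq : E.IsDualFeasible p q) (i : I)
    (hi : p r ≤ p i) {z : ℝ × ExtJet C l p r I} (hz : z ∈ E.time ×ˢ E.extDom p r I) (j : C) :
    (∀ k > q j - p r, coordDeriv (E.diffEqn p r I i) j k z = 0) ∧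
      coordDeriv (E.diffEqn p r I i) j (q j - p r) z =
        E.jacobian p q (z.1, Jet.restrict (fun _ => Nat.le_add_right l _) z.2) i j := by
  have han := hE.2.2.2.2.2 i
  obtain ⟨h1, h2⟩ := coordDeriv_iterDeriv hE.1 hE.2.2.2.1 han j (q j - p i)
    (fun k hk z hz => hpq.coordDeriv_eq_zero hk hz) (p i - p r).toNat
  have hd : (((p i - p r).toNat : ℕ) : ℤ) = p i - p r := Int.toNat_of_nonneg (by omega)
  rw [hd, show q j - p i + (p i - p r) = q j - p r by ring] at h1 h2
  have h3 : ∀ k, coordDeriv (E.diffEqn p r I i) j k z = _ := fun k =>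
    coordDeriv_comp_restrict (fun _ => Nat.add_le_add_left (toNat_le_kappa p r I i) l)
      (analyticOnNhd_iterDeriv han (p i - p r).toNat
        (z.1, Jet.restrict (fun _ => Nat.add_le_add_left (toNat_le_kappa p r I i) l) z.2)
        ⟨hz.1, hz.2⟩).differentiableAt j k
  refine ⟨fun k hk => (h3 k).trans (h1 k hk _ ⟨hz.1, hz.2⟩), ?_⟩
  rw [h3, jacobian_apply]
  exact h2 _ ⟨hz.1, hz.2⟩

/-! ### The substitution `ψ` -/

/-- `xPart` as a continuous linear map. -/
def xPartL (p : R → ℤ) (r : R) (I : Finset R) (J : Finset C) (l : ℕ) :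
    Jet (augOrder (C := C) p r I J l) →L[ℝ] ExtJet C l p r I :=
  ContinuousLinearMap.pi fun c =>
    ContinuousLinearMap.proj (⟨Sum.inl c.1, c.2⟩ : Coord (augOrder (C := C) p r I J l))

/-- The linear part of the affine map `ψ_Ξ`. -/
def psiL (p : R → ℤ) (q : C → ℤ) (r : R) (I : Finset R) (J : Finset C) (l : ℕ) :
    Jet (augOrder (C := C) p r I J l) →L[ℝ] ExtJet C l p r I :=
  LinearMap.toContinuousLinearMap
    { toFun := fun Z => psi p q r I J 0 (xPart Z) (yPart Z)
      map_add' := fun Z Z' => by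
        funext c
        simp only [psi, xPart, yPart, Pi.add_apply, Pi.zero_apply]
        split_ifs <;> simp
      map_smul' := fun a Z => by
        funext c
        simp only [psi, xPart, yPart, Pi.smul_apply, Pi.zero_apply, RingHom.id_apply]
        split_ifs <;> simp }

theorem psi_eq (Ξ : ExtJet C l p r I) (Z : Jet (augOrder (C := C) p r I J l)) :
    psi p q r I J Ξ (xPart Z) (yPart Z) = psiL p q r I J l Z + psi p q r I J Ξ 0 0 := by
  funext c
  simp only [psiL, LinearMap.coe_toContinuousLinearMap', LinearMap.coe_mk, AddHom.coe_mk, psi,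
    Pi.add_apply, Pi.zero_apply]
  split_ifs <;> simp

theorem psi_self (X : ExtJet C l p r I) (y : J → ℝ)
    (hy : ∀ j : J, ∀ k : Fin (l + kappa p r I + 1), ((k : ℕ) : ℤ) = q j - p r → y j = X ⟨j, k⟩) :
    psi p q r I J X X y = X := by
  funext c
  simp only [psi]
  split_ifs with h1 h2
  · exact hy ⟨c.1, h2⟩ c.2 h1
  · rfl
  · rfl

theorem mem_topCoords {c : Coord (fun _ : C => l + kappa p r I)} :
    c ∈ topCoords p q r I J l ↔ c.1 ∈ J ∧ ((c.2 : ℕ) : ℤ) = q c.1 - p r := by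
  simp [topCoords]

/-- The low coordinates of `ψ_Ξ(X, y)` do not depend on `y`. -/
theorem psi_restrict_compl (Ξ X : ExtJet C l p r I) (y y' : J → ℝ) :
    (topCoords p q r I J l)ᶜ.restrict (psi p q r I J Ξ X y) =
      (topCoords p q r I J l)ᶜ.restrict (psi p q r I J Ξ X y') := by
  funext c
  have hc : ¬(c.1.1 ∈ J ∧ ((c.1.2 : ℕ) : ℤ) = q c.1.1 - p r) := fun h =>
    Finset.mem_compl.1 c.2 (mem_topCoords.2 h)
  simp only [Finset.restrict, psi]
  split_ifs with h1 h2
  · exact absurd ⟨h2, h1⟩ hc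
  · rfl
  · rfl

theorem psi_apply_of_mem (Ξ X : ExtJet C l p r I) (y : J → ℝ)
    (c : topCoords p q r I J l) :
    psi p q r I J Ξ X y c = y ⟨c.1.1, (mem_topCoords.1 c.2).1⟩ := by
  have h := mem_topCoords.1 c.2
  simp only [psi, h.1, h.2, if_true, dif_pos]

/-- The top coordinates of `ψ_Ξ(X, y)` depend on `y` only. -/
theorem psi_restrict (Ξ X Ξ' X' : ExtJet C l p r I) (y : J → ℝ) :
    (topCoords p q r I J l).restrict (psi p q r I J Ξ X y) =
      (topCoords p q r I J l).restrict (psi p q r I J Ξ' X' y) := by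
  funext c
  simp only [Finset.restrict, psi_apply_of_mem]

theorem coordDeriv_comp_psi (Ξ : ExtJet C l p r I) {f : ℝ × ExtJet C l p r I → ℝ}
    {z : ℝ × Jet (augOrder (C := C) p r I J l)}
    (hf : DifferentiableAt ℝ f (z.1, psi p q r I J Ξ (xPart z.2) (yPart z.2))) (j : C) (k : ℤ) :
    coordDeriv (fun z : ℝ × Jet (augOrder (C := C) p r I J l) =>
      f (z.1, psi p q r I J Ξ (xPart z.2) (yPart z.2))) (Sum.inl j) k z =
      if k = q j - p r then 0
      else coordDeriv f j k (z.1, psi p q r I J Ξ (xPart z.2) (yPart z.2)) := by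
  simp only [psi_eq] at hf ⊢
  have hA : HasFDerivAt (fun z : ℝ × Jet (augOrder (C := C) p r I J l) =>
      (z.1, psiL p q r I J l z.2 + psi p q r I J Ξ 0 0)) _ z :=
    hasFDerivAt_fst.prodMk
      (((psiL p q r I J l).hasFDerivAt.comp z hasFDerivAt_snd).add_const (psi p q r I J Ξ 0 0))
  have h1 : HasFDerivAt (fun z : ℝ × Jet (augOrder (C := C) p r I J l) =>
      f (z.1, psiL p q r I J l z.2 + psi p q r I J Ξ 0 0)) _ z :=
    HasFDerivAt.comp z hf.hasFDerivAt hA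
  have h2 : psiL p q r I J l (unitDir (augOrder (C := C) p r I J l) (Sum.inl j) k) =
      if k = q j - p r then 0 else unitDir (fun _ => l + kappa p r I) j k := by
    funext c
    obtain ⟨j', k'⟩ := c
    simp only [psiL, LinearMap.coe_toContinuousLinearMap', LinearMap.coe_mk, AddHom.coe_mk, psi,
      xPart, yPart, unitDir, Pi.zero_apply, reduceCtorEq, false_and, if_false, Sum.inl.injEq,
      dite_eq_ite, ite_self]
    by_cases hj : j' = j
    · subst hj
      split_ifs with h1 h2 <;> simp_all [unitDir]
      omega
    · split_ifs with h1 h2 <;> simp_all [unitDir]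
  rw [coordDeriv, h1.fderiv]
  simp only [ContinuousLinearMap.comp_apply, ContinuousLinearMap.prod_apply,
    ContinuousLinearMap.coe_fst', ContinuousLinearMap.coe_snd', h2, coordDeriv]
  split_ifs
  · rw [Prod.mk_zero_zero, map_zero]
  · rfl

theorem analyticAt_comp_psi (Ξ : ExtJet C l p r I) {f : ℝ × ExtJet C l p r I → ℝ}
    {z : ℝ × Jet (augOrder (C := C) p r I J l)}
    (hf : AnalyticAt ℝ f (z.1, psi p q r I J Ξ (xPart z.2) (yPart z.2))) :
    AnalyticAt ℝ (fun z : ℝ × Jet (augOrder (C := C) p r I J l) =>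
      f (z.1, psi p q r I J Ξ (xPart z.2) (yPart z.2))) z := by
  simp only [psi_eq] at hf ⊢
  exact AnalyticAt.fun_comp (f := fun z : ℝ × Jet (augOrder (C := C) p r I J l) =>
      (z.1, psiL p q r I J l z.2 + psi p q r I J Ξ 0 0)) hf
    (analyticAt_fst.prod ((((psiL p q r I J l).analyticAt _).comp analyticAt_snd).add
      analyticAt_const))

/-! ### The domain and the analyticity of the augmented system -/

namespace ImplicitSolution

variable (S : E.ImplicitSolution p q r I J)

theorem continuous_restrict {ι : Type*} (s : Finset ι) :
    Continuous (s.restrict : (ι → ℝ) → s → ℝ) :=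
  continuous_pi fun c => continuous_apply c.1

theorem isOpen_dom : IsOpen S.dom :=
  (S.isOpen_V.preimage (continuous_restrict _)).inter (S.isOpen_W.preimage (continuous_restrict _))

theorem dom_subset : S.dom ⊆ E.extDom p r I := fun X hX => S.subset_extDom X hX.1 hX.2

theorem base_mem_dom : S.base.2 ∈ S.dom := ⟨S.base_V_mem, S.base_W_mem⟩

end ImplicitSolution

variable (S : E.ImplicitSolution p q r I J)

theorem augmentation_eqn_inl (Ξ : ExtJet C l p r I) {i : R} (hi : i ≠ r) :
    (augmentation S Ξ).eqn (Sum.inl i) = fun z => E.extEqn p r I i (z.1, xPart z.2) := by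
  funext z
  exact if_neg hi

theorem augmentation_eqn_r (Ξ : ExtJet C l p r I) :
    (augmentation S Ξ).eqn (Sum.inl r) = fun z =>
      E.extEqn p r I r (z.1, psi p q r I J Ξ (xPart z.2) (yPart z.2)) := by
  funext z
  exact if_pos rfl

/-- The domain is a product: the part of `ψ_Ξ(X, y)` in `V` depends on `X` only, the part in `W`
depends on `y` only. -/
theorem augmentation_dom (Ξ : ExtJet C l p r I) :
    (augmentation S Ξ).dom =
      {Z | xPart Z ∈ {X | X ∈ S.dom ∧
          (topCoords p q r I J l)ᶜ.restrict (psi p q r I J Ξ X 0) ∈ S.V} ∧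
        yPart Z ∈ {y | (topCoords p q r I J l).restrict (psi p q r I J Ξ Ξ y) ∈ S.W}} := by
  ext Z
  have h1 := psi_restrict_compl (q := q) Ξ (xPart Z) (yPart Z) 0
  have h2 := psi_restrict (q := q) Ξ (xPart Z) Ξ Ξ (yPart Z)
  simp only [augmentation, ImplicitSolution.dom, Set.mem_ofPred_eq, h1, h2]
  tauto

theorem isOpen_augmentation_dom (Ξ : ExtJet C l p r I) : IsOpen (augmentation S Ξ).dom := by
  have h : Continuous fun Z : Jet (augOrder (C := C) p r I J l) =>
      psi p q r I J Ξ (xPart Z) (yPart Z) := by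
    simp only [psi_eq]
    exact (psiL p q r I J l).continuous.add continuous_const
  exact (S.isOpen_dom.preimage (xPartL p r I J l).continuous).inter (S.isOpen_dom.preimage h)

theorem exists_augmentation_dom_eq_prod (Ξ : ExtJet C l p r I) :
    ∃ (Ω' : Set (ExtJet C l p r I)) (Y : Set (J → ℝ)),
      IsOpen Ω' ∧ IsOpen Y ∧ Ω' ⊆ E.extDom p r I ∧
      (augmentation S Ξ).dom = {Z | xPart Z ∈ Ω' ∧ yPart Z ∈ Y} := by
  refine ⟨_, _, ?_, ?_, ?_, augmentation_dom S Ξ⟩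
  · refine S.isOpen_dom.inter (S.isOpen_V.preimage ((ImplicitSolution.continuous_restrict _).comp
      (continuous_pi fun c => ?_)))
    simp only [psi]
    split_ifs <;> fun_prop
  · refine S.isOpen_W.preimage ((ImplicitSolution.continuous_restrict _).comp
      (continuous_pi fun c => ?_))
    simp only [psi]
    split_ifs <;> fun_prop
  · exact fun X hX => S.dom_subset hX.1

theorem augmentation_dom_nonempty {Ξ : ExtJet C l p r I} (hΞ : Ξ ∈ S.dom) :
    (augmentation S Ξ).dom.Nonempty := by
  let y : J → ℝ := fun j =>
    if h : (q j - p r).toNat < l + kappa p r I + 1 then Ξ ⟨j, (q j - p r).toNat, h⟩ else 0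
  refine ⟨fun c => match c with
    | ⟨Sum.inl j, k⟩ => Ξ ⟨j, k⟩
    | ⟨Sum.inr j, _⟩ => y j, hΞ, ?_⟩
  have : psi p q r I J Ξ Ξ y = Ξ := psi_self Ξ y fun j k hk => by
    have h2 : (q j - p r).toNat = k := by omega
    have h3 := k.2
    simp only [y, h2, h3, dif_pos]
  exact this.symm ▸ hΞ

theorem augmentation_isRealAnalytic (hE : E.IsRealAnalytic) {Ξ : ExtJet C l p r I}
    (hΞ : Ξ ∈ S.dom) : (augmentation S Ξ).IsRealAnalytic := by
  refine ⟨S.isOpen_time, S.ordConnected_time, ⟨_, S.base_time_mem⟩, isOpen_augmentation_dom S Ξ,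
    augmentation_dom_nonempty S hΞ, ?_⟩
  rintro (i | i) z ⟨hz1, hz2, hz3⟩
  · by_cases hi : i = r
    · subst hi
      rw [augmentation_eqn_r]
      exact analyticAt_comp_psi Ξ (analyticAt_extEqn hE i ⟨S.time_subset hz1, S.dom_subset hz3⟩)
    · rw [augmentation_eqn_inl S Ξ hi]
      exact AnalyticAt.fun_comp (f := fun z : ℝ × Jet (augOrder (C := C) p r I J l) =>
          (z.1, xPart z.2)) (analyticAt_extEqn hE i ⟨S.time_subset hz1, S.dom_subset hz2⟩)
        (analyticAt_fst.prod (((xPartL p r I J l).analyticAt _).comp analyticAt_snd))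
  · exact analyticAt_comp_psi Ξ (analyticAt_diffEqn hE i ⟨S.time_subset hz1, S.dom_subset hz3⟩)

/-! ### The dual problem of the augmented system -/

theorem coordDeriv_augmentation_inl (hE : E.IsRealAnalytic) (Ξ : ExtJet C l p r I) {i : R}
    (hi : i ≠ r) {z : ℝ × Jet (augOrder (C := C) p r I J l)}
    (hz : z ∈ (augmentation S Ξ).time ×ˢ (augmentation S Ξ).dom) (k : ℤ) :
    (∀ j, coordDeriv ((augmentation S Ξ).eqn (Sum.inl i)) (Sum.inl j) k z =
        coordDeriv (E.extEqn p r I i) j k (z.1, xPart z.2)) ∧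
      ∀ j, coordDeriv ((augmentation S Ξ).eqn (Sum.inl i)) (Sum.inr j) k z = 0 := by
  rw [augmentation_eqn_inl S Ξ hi]
  have hx : (z.1, xPart z.2) ∈ E.time ×ˢ E.extDom p r I :=
    ⟨S.time_subset hz.1, S.dom_subset hz.2.1⟩
  have hf : DifferentiableAt ℝ (E.extEqn p r I i) (z.1, xPart z.2) :=
    (analyticAt_extEqn hE i hx).differentiableAt
  have hA : HasFDerivAt (fun z : ℝ × Jet (augOrder (C := C) p r I J l) => (z.1, xPart z.2)) _ z :=
    hasFDerivAt_fst.prodMk ((xPartL p r I J l).hasFDerivAt.comp z hasFDerivAt_snd)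
  have h1 : HasFDerivAt (fun z : ℝ × Jet (augOrder (C := C) p r I J l) =>
      E.extEqn p r I i (z.1, xPart z.2)) _ z :=
    HasFDerivAt.comp (g := E.extEqn p r I i) z hf.hasFDerivAt hA
  have h2 : ∀ j, xPartL p r I J l (unitDir (augOrder (C := C) p r I J l) (Sum.inl j) k) =
      unitDir (fun _ => l + kappa p r I) j k := fun j => by
    funext c
    simp [xPartL, unitDir]
  have h3 : ∀ j, xPartL p r I J l (unitDir (augOrder (C := C) p r I J l) (Sum.inr j) k) = 0 :=
    fun j => by
      funext c
      simp [xPartL, unitDir]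
  constructor
  · intro j
    rw [coordDeriv, h1.fderiv]
    simp [h2, coordDeriv]
  · intro j
    rw [coordDeriv, h1.fderiv]
    simp only [ContinuousLinearMap.comp_apply, ContinuousLinearMap.prod_apply,
      ContinuousLinearMap.coe_fst', ContinuousLinearMap.coe_snd', h3]
    exact map_zero _

/-- In the equations `F_r(t, ψ) = 0` and `F_i^{(p_i - p_r)}(t, ψ) = 0` the order of `x_j` is less than
`q_j - p_r`, since `x_j^{(q_j - p_r)}` has been replaced. So the values of the dual variables for these
equations and for `y` may be raised by `1`. -/
theorem augmentation_isDualFeasible (hE : E.IsRealAnalytic) (hpq : E.IsDualFeasible p q)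
    (hI : ∀ i ∈ I, p r ≤ p i) (Ξ : ExtJet C l p r I) {u : ℤ} (hu : u ≤ 1) :
    (augmentation S Ξ).IsDualFeasible
      (Sum.elim (fun i => p i + if i ∈ ({r} : Finset R) then u else 0) fun _ => p r + u)
      (Sum.elim q fun _ => p r + u) := by
  rw [isDualFeasible_iff]
  rintro a b k ⟨z, hz, hne⟩
  rw [← coordDeriv_coe] at hne
  have hx : (z.1, xPart z.2) ∈ E.time ×ˢ E.extDom p r I :=
    ⟨S.time_subset hz.1, S.dom_subset hz.2.1⟩
  have hψ : (z.1, psi p q r I J Ξ (xPart z.2) (yPart z.2)) ∈ E.time ×ˢ E.extDom p r I :=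
    ⟨S.time_subset hz.1, S.dom_subset hz.2.2⟩
  have hk0 : ∀ j : J, b = Sum.inr j → (k : ℕ) = 0 := by
    rintro j rfl
    exact Nat.lt_one_iff.1 k.2
  obtain i | i := a
  · by_cases hi : i = r
    · subst hi
      obtain j | j := b
      · rw [augmentation_eqn_r,
          coordDeriv_comp_psi Ξ (analyticAt_extEqn hE i hψ).differentiableAt] at hne
        split_ifs at hne with hk
        · exact absurd rfl hne
        · rw [coordDeriv_extEqn hE i hψ] at hne
          have : ¬ q j - p i < k := fun h => hne (hpq.coordDeriv_eq_zero h hψ)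
          simp only [Sum.elim_inl, Finset.mem_singleton, if_true]
          omega
      · simp [hk0 j rfl]
    · obtain j | j := b
      · rw [(coordDeriv_augmentation_inl S hE Ξ hi hz _).1, coordDeriv_extEqn hE i hx] at hne
        have : ¬ q j - p i < k := fun h => hne (hpq.coordDeriv_eq_zero h hx)
        simp only [Sum.elim_inl, Finset.mem_singleton, hi, if_false]
        omega
      · exact absurd ((coordDeriv_augmentation_inl S hE Ξ hi hz _).2 j) hne
  · obtain j | j := b
    · have h1 := coordDeriv_comp_psi (q := q) (J := J) Ξ (z := z)
        (analyticAt_diffEqn hE i hψ).differentiableAt j k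
      have h2 : coordDeriv ((augmentation S Ξ).eqn (Sum.inr i)) (Sum.inl j) k z = _ := h1
      rw [h2] at hne
      split_ifs at hne with hk
      · exact absurd rfl hne
      · have : ¬ q j - p r < k := fun h =>
          hne ((coordDeriv_diffEqn hE hpq i (hI i i.2) hψ j).1 k h)
        simp only [Sum.elim_inl, Sum.elim_inr]
        omega
    · simp [hk0 j rfl]

/-- The values `u = 0` and `u = 1` in `augmentation_isDualFeasible` give a feasible solution and a better
one. -/
theorem augmentation_dual (hE : E.IsRealAnalytic) (hpq : E.IsDualOptimal p q)
    (hI : ∀ i ∈ I, p r ≤ p i) (hIJ : I.card = J.card) (Ξ : ExtJet C l p r I) :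
    (augmentation S Ξ).IsDualFeasible (Sum.elim p fun _ => p r) (Sum.elim q fun _ => p r) ∧
      ¬ (augmentation S Ξ).IsDualOptimal (Sum.elim p fun _ => p r) (Sum.elim q fun _ => p r) ∧
      (augmentation S Ξ).deltaHat + 1 ≤ E.deltaHat := by
  have h0 := augmentation_isDualFeasible S hE hpq.1 hI Ξ (u := 0) zero_le_one
  have h1 := augmentation_isDualFeasible S hE hpq.1 hI Ξ (u := 1) le_rfl
  simp only [ite_self, add_zero] at h0
  have hv0 : dualValue (Sum.elim p fun _ : I => p r) (Sum.elim q fun _ : J => p r) =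
      dualValue p q := by
    simp [dualValue, Fintype.sum_sum_type, hIJ]
  have hv1 : dualValue
      (Sum.elim (fun i => p i + if i ∈ ({r} : Finset R) then 1 else 0) fun _ : I => p r + 1)
      (Sum.elim q fun _ : J => p r + 1) = dualValue p q - 1 := by
    simp only [dualValue, Fintype.sum_sum_type, Sum.elim_inl, Sum.elim_inr,
      Finset.sum_add_distrib, Finset.sum_ite_mem, Finset.univ_inter, Finset.sum_const,
      Finset.card_univ, Fintype.card_coe, hIJ, Finset.card_singleton]
    simp
    ring
  refine ⟨h0, fun h => ?_, ?_⟩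
  · have := h.2 _ _ h1
    rw [hv0, hv1] at this
    omega
  · have := h1.deltaHat_le
    rw [hv1] at this
    rw [hpq.deltaHat_eq]
    refine (add_le_add_left this 1).trans (le_of_eq ?_)
    norm_cast
    rw [sub_add_cancel]

end Method

end System

/-! ### Low and top coordinates -/

/-- A vector supported on the coordinates `x_j^{(o_j)}` is of the form `orderDir`. The speed `w_j` is not
determined if `x_j^{(o_j)}` is not a coordinate; it is chosen to be `0` then. -/
theorem exists_eq_orderDir {C : Type*} [Fintype C] [DecidableEq C] {N : C → ℕ} {o : C → ℤ}
    {Y : Jet N} (h : ∀ c : Coord N, ((c.2 : ℕ) : ℤ) ≠ o c.1 → Y c = 0) :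
    ∃ w : C → ℝ, Y = orderDir N o w ∧
      ∀ j, (∀ k : Fin (N j + 1), ((k : ℕ) : ℤ) = o j → Y ⟨j, k⟩ = 0) → w j = 0 := by
  refine ⟨fun j => ∑ k : Fin (N j + 1), if ((k : ℕ) : ℤ) = o j then Y ⟨j, k⟩ else 0, ?_, ?_⟩
  · funext c
    obtain ⟨j, k⟩ := c
    simp only [orderDir]
    split_ifs with hk
    · rw [Finset.sum_eq_single k]
      · rw [if_pos hk]
      · intro k' _ hne
        refine if_neg fun h => hne (Fin.ext ?_)
        exact_mod_cast h.trans hk.symm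
      · simp
    · exact h _ hk
  · intro j hj
    refine Finset.sum_eq_zero fun k _ => ?_
    split_ifs with hk
    · exact hj k hk
    · rfl

namespace System

variable {R C : Type*} [Fintype R] [DecidableEq R] [Fintype C] [DecidableEq C]
  {l : ℕ} {E : System R (fun _ : C => l)} {p : R → ℤ} {q : C → ℤ} {r : R} {I : Finset R}
  {J : Finset C}

/-- The jet with given low coordinates (those outside `topCoords`) and top coordinates (those in
`topCoords`). -/
def combineL (p : R → ℤ) (q : C → ℤ) (r : R) (I : Finset R) (J : Finset C) (l : ℕ) :
    ((((topCoords p q r I J l)ᶜ : Finset _) → ℝ) × (topCoords p q r I J l → ℝ)) →L[ℝ]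
      ExtJet C l p r I :=
  ContinuousLinearMap.pi fun c =>
    if h : c ∈ topCoords p q r I J l then
      (ContinuousLinearMap.proj (⟨c, h⟩ : topCoords p q r I J l)).comp
        (ContinuousLinearMap.snd ℝ _ _)
    else
      (ContinuousLinearMap.proj
        (⟨c, Finset.mem_compl.2 h⟩ : ((topCoords p q r I J l)ᶜ : Finset _))).comp
        (ContinuousLinearMap.fst ℝ _ _)

theorem combineL_apply_of_mem {v : ((topCoords p q r I J l)ᶜ : Finset _) → ℝ}
    {w : topCoords p q r I J l → ℝ} (c : topCoords p q r I J l) :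
    combineL p q r I J l (v, w) c = w c := by
  simp [combineL, c.2]

theorem combineL_apply_of_mem_compl {v : ((topCoords p q r I J l)ᶜ : Finset _) → ℝ}
    {w : topCoords p q r I J l → ℝ} (c : ((topCoords p q r I J l)ᶜ : Finset _)) :
    combineL p q r I J l (v, w) c = v c := by
  simp [combineL, Finset.mem_compl.1 c.2]

theorem restrict_combineL (v : ((topCoords p q r I J l)ᶜ : Finset _) → ℝ)
    (w : topCoords p q r I J l → ℝ) :
    (topCoords p q r I J l).restrict (combineL p q r I J l (v, w)) = w :=
  funext fun c => combineL_apply_of_mem c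

theorem restrict_compl_combineL (v : ((topCoords p q r I J l)ᶜ : Finset _) → ℝ)
    (w : topCoords p q r I J l → ℝ) :
    (topCoords p q r I J l)ᶜ.restrict (combineL p q r I J l (v, w)) = v :=
  funext fun c => combineL_apply_of_mem_compl c

theorem combineL_restrict (X : ExtJet C l p r I) :
    combineL p q r I J l ((topCoords p q r I J l)ᶜ.restrict X,
      (topCoords p q r I J l).restrict X) = X := by
  funext c
  by_cases h : c ∈ topCoords p q r I J l
  · exact combineL_apply_of_mem (⟨c, h⟩ : topCoords p q r I J l)
  · exact combineL_apply_of_mem_compl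
      (⟨c, Finset.mem_compl.2 h⟩ : ((topCoords p q r I J l)ᶜ : Finset _))

/-! ### Existence of an implicit solution -/

theorem eventually_nonsingAt (hE : E.IsRealAnalytic) {z : ℝ × Jet (fun _ : C => l)}
    (hz : z ∈ E.time ×ˢ E.dom) (h : E.NonsingAt p q I J z) :
    ∀ᶠ z' in 𝓝 z, E.NonsingAt p q I J z' := by
  obtain ⟨e, he⟩ := h
  have hc : ContinuousAt (fun z' => (((E.jacobian p q z').submatrix (fun i : I => (i : R))
      (fun j : J => (j : C))).submatrix id e)) z := by
    refine continuousAt_pi.2 fun i => continuousAt_pi.2 fun i' => ?_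
    simp only [Matrix.submatrix_apply, jacobian_apply, coordDeriv]
    exact ((hE.2.2.2.2.2 i z hz).fderiv.continuousAt).clm_apply continuousAt_const
  have hdet : ContinuousAt (fun z' => (((E.jacobian p q z').submatrix (fun i : I => (i : R))
      (fun j : J => (j : C))).submatrix id e).det) z :=
    (Continuous.matrix_det continuous_id).continuousAt.comp hc
  exact (hdet.eventually_ne he).mono fun z' hz' => ⟨e, hz'⟩

/-- For `j ∈ J`, the coordinate `x_j^{(q_j - p_r)}` exists: the `j`-th column of `D[I, J]` is not zero, so
`0 ≤ q_j - p_i ≤ l` for some `i ∈ I`. -/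
theorem exists_top_order (hIJ : I.card = J.card) (hI : ∀ i ∈ I, p r ≤ p i)
    {z : ℝ × Jet (fun _ : C => l)} (h : E.NonsingAt p q I J z) (j : J) :
    ∃ k : Fin (l + kappa p r I + 1), ((k : ℕ) : ℤ) = q j - p r := by
  rw [NonsingAt, nonsing_iff_forall_mulVec _ (Finset.equivOfCardEq hIJ)] at h
  obtain ⟨i, hi⟩ : ∃ i : I, E.jacobian p q z i j ≠ 0 := by
    by_contra hcon
    push Not at hcon
    have := congrFun (h (Pi.single j 1) fun i => by simp [Pi.single_apply, hcon i]) j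
    simp at this
  rw [jacobian_apply] at hi
  obtain ⟨k, hk⟩ : ∃ k : Fin (l + 1), ((k : ℕ) : ℤ) = q j - p i := by
    by_contra hcon
    push Not at hcon
    exact hi (DAE.coordDeriv_eq_zero _ _ _ hcon z)
  have h1 := hI i i.2
  have h2 := toNat_le_kappa p r I i
  refine ⟨⟨k + (p i - p r).toNat, ?_⟩, ?_⟩
  · have := k.2
    omega
  · push_cast
    rw [Int.toNat_of_nonneg (by omega)]
    omega

/-- Each `j ∈ J` has exactly one top coordinate, so the differentiated equations are as many as the
coordinates that they determine. -/
theorem card_topCoords (h : ∀ j : J, ∃ k : Fin (l + kappa p r I + 1), ((k : ℕ) : ℤ) = q j - p r) :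
    (topCoords p q r I J l).card = J.card := by
  refine Finset.card_bij (fun c _ => c.1) (fun c hc => (mem_topCoords.1 hc).1) ?_ ?_
  · rintro ⟨j, k⟩ hc ⟨j', k'⟩ hc' hjj
    obtain rfl : j = j' := hjj
    have h1 := (mem_topCoords.1 hc).2
    have h2 := (mem_topCoords.1 hc').2
    have : k = k' := Fin.ext (by exact_mod_cast h1.trans h2.symm)
    rw [this]
  · intro j hj
    obtain ⟨k, hk⟩ := h ⟨j, hj⟩
    exact ⟨⟨j, k⟩, mem_topCoords.2 ⟨hj, hk⟩, rfl⟩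

/-- The Jacobian matrix of the functions `F_i^{(p_i - p_r)}` (`i ∈ I`) with respect to the coordinates
`x_j^{(q_j - p_r)}` is `D[I, C]`. -/
theorem fderiv_diffEqn_orderDir (hE : E.IsRealAnalytic) (hpq : E.IsDualFeasible p q) (i : I)
    (hi : p r ≤ p i) {z : ℝ × ExtJet C l p r I} (hz : z ∈ E.time ×ˢ E.extDom p r I)
    (w : C → ℝ) :
    fderiv ℝ (E.diffEqn p r I i) z (0, orderDir _ (fun j => q j - p r) w) =
      ∑ j, E.jacobian p q (z.1, Jet.restrict (fun _ => Nat.le_add_right l _) z.2) i j * w j := by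
  rw [fderiv_orderDir]
  exact Finset.sum_congr rfl fun j _ => by rw [(coordDeriv_diffEqn hE hpq i hi hz j).2]

theorem exists_implicitSolution_of_zero (hE : E.IsRealAnalytic) (hpq : E.IsDualFeasible p q)
    (hIJ : I.card = J.card) (hI : ∀ i ∈ I, p r ≤ p i) {b : ℝ × ExtJet C l p r I}
    (hb : b ∈ E.time ×ˢ E.extDom p r I) (hb0 : ∀ i, E.diffEqn p r I i b = 0)
    (hns : E.NonsingAt p q I J (b.1, Jet.restrict (fun _ => Nat.le_add_right l _) b.2)) :
    Nonempty (E.ImplicitSolution p q r I J) := by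
  set top := topCoords p q r I J l with htop
  let L : (ℝ × ((topᶜ : Finset _) → ℝ)) × (top → ℝ) →L[ℝ] ℝ × ExtJet C l p r I :=
    ((ContinuousLinearMap.fst ℝ _ _).comp (ContinuousLinearMap.fst ℝ _ _)).prod
      ((combineL p q r I J l).comp
        (((ContinuousLinearMap.snd ℝ _ _).comp (ContinuousLinearMap.fst ℝ _ _)).prod
          (ContinuousLinearMap.snd ℝ _ _)))
  have hL : ∀ t v w, L ((t, v), w) = (t, combineL p q r I J l (v, w)) := fun _ _ _ => rfl
  let u : (ℝ × ((topᶜ : Finset _) → ℝ)) × (top → ℝ) :=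
    ((b.1, topᶜ.restrict b.2), top.restrict b.2)
  have hLu : L u = b := by rw [hL, combineL_restrict]
  let G : (ℝ × ((topᶜ : Finset _) → ℝ)) × (top → ℝ) → I → ℝ := fun u i => E.diffEqn p r I i (L u)
  have hGan : ∀ i, AnalyticAt ℝ (fun u => E.diffEqn p r I i (L u)) u := fun i =>
    AnalyticAt.fun_comp (by rw [hLu]; exact analyticAt_diffEqn hE i hb) (L.analyticAt u)
  have hG : ContDiffAt ℝ ω G u := contDiffAt_pi.2 fun i => (hGan i).contDiffAt
  have hGu : G u = 0 := funext fun i => by simp only [G, hLu, hb0, Pi.zero_apply]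
  have hfd : ∀ w i, fderiv ℝ G u (0, w) i =
      fderiv ℝ (E.diffEqn p r I i) b (0, combineL p q r I J l (0, w)) := by
    intro w i
    have h1 : HasFDerivAt G (ContinuousLinearMap.pi fun i =>
        (fderiv ℝ (E.diffEqn p r I i) b).comp L) u := by
      refine hasFDerivAt_pi.2 fun i => ?_
      have := (analyticAt_diffEqn hE i hb).differentiableAt.hasFDerivAt
      rw [← hLu] at this ⊢
      exact this.comp u L.hasFDerivAt
    rw [h1.fderiv]
    rfl
  have hcardtop : top.card = J.card := card_topCoords (exists_top_order hIJ hI hns)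
  -- an element of the kernel, as a vector indexed by `J`, is in the kernel of `D[I, J]`
  have hinj : Function.Injective (fderiv ℝ G u ∘L ContinuousLinearMap.inr ℝ _ _) := by
    refine (injective_iff_map_eq_zero _).2 fun w hw => ?_
    have hoff : ∀ c : Coord (fun _ : C => l + kappa p r I), c ∉ top →
        combineL p q r I J l (0, w) c = 0 := fun c hc =>
      combineL_apply_of_mem_compl (⟨c, Finset.mem_compl.2 hc⟩ : (topᶜ : Finset _))
    obtain ⟨w', hw', hw0⟩ := exists_eq_orderDir (o := fun j => q j - p r)
      (Y := combineL p q r I J l (0, w))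
      fun c hc => hoff c fun h => hc (mem_topCoords.1 h).2
    have hker : ∀ i : I, ∑ j : J, E.jacobian p q
        (b.1, Jet.restrict (fun _ => Nat.le_add_right l _) b.2) i j * w' j = 0 := by
      intro i
      have h1 := congrFun hw i
      simp only [ContinuousLinearMap.comp_apply, ContinuousLinearMap.inr_apply, hfd, hw',
        Pi.zero_apply] at h1
      rw [fderiv_diffEqn_orderDir hE hpq i (hI i i.2) hb] at h1
      rw [← h1, Finset.sum_coe_sort J fun j => E.jacobian p q
        (b.1, Jet.restrict (fun _ => Nat.le_add_right l _) b.2) i j * w' j]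
      refine Finset.sum_subset (Finset.subset_univ _) fun j _ hj => ?_
      rw [hw0 j fun k _ => hoff _ fun h => hj (mem_topCoords.1 h).1, mul_zero]
    have hwJ := (nonsing_iff_forall_mulVec _ (Finset.equivOfCardEq hIJ)).1 hns
      (fun j => w' j) hker
    funext c
    rw [← combineL_apply_of_mem (v := 0) (w := w) c, hw']
    simp only [orderDir]
    split_ifs
    · exact congrFun hwJ ⟨c.1.1, (mem_topCoords.1 c.2).1⟩
    · rfl
  have hinv : (fderiv ℝ G u ∘L ContinuousLinearMap.inr ℝ _ _).IsInvertible := by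
    have hrank : Module.finrank ℝ (top → ℝ) = Module.finrank ℝ (I → ℝ) := by
      simp [hcardtop, hIJ]
    refine ⟨(LinearEquiv.ofInjectiveOfFinrankEq
      (fderiv ℝ G u ∘L ContinuousLinearMap.inr ℝ _ _).toLinearMap hinj
      hrank).toContinuousLinearEquiv, ?_⟩
    ext w
    rfl
  have hω : (ω : WithTop ℕ∞) ≠ 0 := by simp
  let φ := hG.implicitFunction hω hinv
  have hφu : φ u.1 = u.2 := hG.implicitFunction_apply_self hω hinv
  have hφan : AnalyticAt ℝ φ u.1 := (hG.contDiffAt_implicitFunction hω hinv).analyticAt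
  have hLc : Filter.Tendsto L (𝓝 u) (𝓝 b) := by
    have := L.continuous.tendsto u
    rwa [hLu] at this
  have hrc : Filter.Tendsto (fun z : ℝ × ExtJet C l p r I =>
      (z.1, Jet.restrict (fun _ => Nat.le_add_right l _) z.2)) (𝓝 b)
      (𝓝 (b.1, Jet.restrict (fun _ => Nat.le_add_right l _) b.2)) :=
    (continuous_fst.prodMk ((restrictL fun _ => Nat.le_add_right l _).continuous.comp
      continuous_snd)).tendsto b
  have hev : ∀ᶠ v in 𝓝 u, (L v ∈ E.time ×ˢ E.extDom p r I ∧
      E.NonsingAt p q I J ((L v).1, Jet.restrict (fun _ => Nat.le_add_right l _) (L v).2)) ∧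
      (G v = 0 ↔ φ v.1 = v.2) := by
    refine ((hLc.eventually ((hE.1.prod (isOpen_extDom hE)).mem_nhds hb)).and
      (hLc.eventually (hrc.eventually (eventually_nonsingAt hE ⟨hb.1, hb.2⟩ hns)))).and ?_
    have := hG.eventually_apply_eq_iff_implicitFunction hω hinv
    rwa [hGu] at this
  obtain ⟨ε, hε, hball⟩ := Metric.eventually_nhds_iff_ball.1 hev
  have hφW : ∀ᶠ a in 𝓝 u.1, φ a ∈ Metric.ball u.2 ε := by
    have := hφan.continuousAt
    rw [ContinuousAt, hφu] at this
    exact this.eventually (Metric.ball_mem_nhds _ hε)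
  obtain ⟨δ', hδ', hball'⟩ := Metric.eventually_nhds_iff_ball.1
    (hφW.and hφan.eventually_analyticAt)
  -- the radius for `(t, v)` is at most the radius `ε` for `w`, so that both conclusions apply
  obtain ⟨δ, hδ, hδε, hδδ⟩ : ∃ δ > 0, δ ≤ ε ∧ δ ≤ δ' :=
    ⟨min ε δ', lt_min hε hδ', min_le_left _ _, min_le_right _ _⟩
  have hmem : ∀ t ∈ Metric.ball b.1 δ, ∀ v ∈ Metric.ball (topᶜ.restrict b.2) δ,
      (t, v) ∈ Metric.ball u.1 δ' := fun t ht v hv => by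
    rw [← ball_prod_same]
    exact ⟨Metric.ball_subset_ball hδδ ht, Metric.ball_subset_ball hδδ hv⟩
  have hmem' : ∀ t ∈ Metric.ball b.1 δ, ∀ v ∈ Metric.ball (topᶜ.restrict b.2) δ,
      ∀ w ∈ Metric.ball (top.restrict b.2) ε, ((t, v), w) ∈ Metric.ball u ε :=
    fun t ht v hv w hw => by
      rw [← ball_prod_same, ← ball_prod_same]
      exact ⟨⟨Metric.ball_subset_ball hδε ht, Metric.ball_subset_ball hδε hv⟩, hw⟩
  have hb1 := Metric.mem_ball_self (x := b.1) hδ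
  exact ⟨{
    time := Metric.ball b.1 δ
    V := Metric.ball (topᶜ.restrict b.2) δ
    W := Metric.ball (top.restrict b.2) ε
    phi := φ
    base := b
    isOpen_time := Metric.isOpen_ball
    ordConnected_time := (convex_ball _ _).ordConnected
    isOpen_V := Metric.isOpen_ball
    convex_V := convex_ball _ _
    isOpen_W := Metric.isOpen_ball
    time_subset := fun t ht =>
      (hball _ (hmem' t ht _ (Metric.mem_ball_self hδ) _ (Metric.mem_ball_self hε))).1.1.1
    subset_extDom := fun X hV hW => by
      have := (hball _ (hmem' _ hb1 _ hV _ hW)).1.1.2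
      rwa [hL, combineL_restrict] at this
    base_time_mem := hb1
    base_V_mem := Metric.mem_ball_self hδ
    base_W_mem := Metric.mem_ball_self hε
    base_zero := hb0
    analyticOnNhd_phi := fun a ha => (hball' _ (hmem _ ha.1 _ ha.2)).2
    mapsTo_phi := fun a ha => (hball' _ (hmem _ ha.1 _ ha.2)).1
    zero_iff := fun t ht X hV hW => by
      have := (hball _ (hmem' _ ht _ hV _ hW)).2
      simp only [G, hL, combineL_restrict, funext_iff, Pi.zero_apply] at this
      rw [this]
      exact ⟨fun h => funext fun c => (h c).symm, fun h c => (congrFun h c).symm⟩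
    nonsing := fun t ht X hV hX => by
      have hW : top.restrict X ∈ Metric.ball (top.restrict b.2) ε := by
        rw [hX]
        exact (hball' _ (hmem _ ht _ hV)).1
      have := (hball _ (hmem' _ ht _ hV _ hW)).1.2
      rwa [hL, combineL_restrict] at this }⟩

theorem diffEqn_ofTrajectory_eq_zero (hE : E.IsRealAnalytic) {x : ℝ → C → ℝ} {T : Set ℝ}
    (hT : IsOpen T) (hTE : T ⊆ E.time)
    (hx : ∀ j, ContDiffOn ℝ (l + kappa p r I : ℕ) (fun t => x t j) T)
    (hdom : ∀ t ∈ T, ofTrajectory (fun _ => l) x t ∈ E.dom) (i : I)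
    (h0 : ∀ t ∈ T, E.eqn i (t, ofTrajectory (fun _ => l) x t) = 0) :
    ∀ t ∈ T, E.diffEqn p r I i (t, ofTrajectory (fun _ => l + kappa p r I) x t) = 0 :=
  iterDeriv_ofTrajectory_eq_zero hT hTE (hE.2.2.2.2.2 i) hdom h0 (p i - p r).toNat fun j =>
    (hx j).of_le (by exact_mod_cast Nat.add_le_add_left (toNat_le_kappa p r I i) l)

/-- A consistent point at which `D[I, J]` is nonsingular, extended by the higher derivatives of the
solution, is a common zero to which the implicit function theorem applies. -/
theorem nonempty_implicitSolution (hE : E.IsRealAnalytic) (hpq : E.IsDualFeasible p q)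
    (hcons : E.NonsingAtConsistent p q) (hadm : E.IsAdmissible p q r I J) :
    Nonempty (E.ImplicitSolution p q r I J) := by
  obtain ⟨z, hz, ⟨T, x, hT, -, hzT, hx, hsol, hxz⟩, hns⟩ :=
    hcons I J hadm.card_eq hadm.nonsingular
  have hres : (z.1, Jet.restrict (fun _ => Nat.le_add_right l _)
      (ofTrajectory (fun _ => l + kappa p r I) x z.1)) = z := Prod.ext rfl hxz
  refine exists_implicitSolution_of_zero hE hpq hadm.card_eq hadm.le
    (b := (z.1, ofTrajectory (fun _ => l + kappa p r I) x z.1)) ⟨hz.1, ?_⟩ (fun i => ?_) ?_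
  · have := hz.2
    rw [← hxz] at this
    exact this
  · exact diffEqn_ofTrajectory_eq_zero hE hT (fun t ht => (hsol.2 t ht).1)
      (fun j => (contDiffOn_pi.1 hx j).of_le (by exact_mod_cast le_top))
      (fun t ht => (hsol.2 t ht).2.1) i (fun t ht => (hsol.2 t ht).2.2 i) _ hzT
  · exact hres.symm ▸ hns

/-! ### Equivalence of the solutions -/

/-- On the zero set of the differentiated equations, `F_r` does not depend on the coordinates
`x_j^{(q_j - p_r)}`. Along a segment in these coordinates inside the zero set, the velocity is annihilated
by the rows of `D` in `I`, hence by the row `r`, which is a combination of them. -/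
theorem extEqn_eq_of_agree (hE : E.IsRealAnalytic) (hpq : E.IsDualFeasible p q)
    (hadm : E.IsAdmissible p q r I J) (S : E.ImplicitSolution p q r I J) {t : ℝ} (ht : t ∈ S.time)
    {X X' : ExtJet C l p r I} (hX : X ∈ S.dom) (hX' : X' ∈ S.dom)
    (hX0 : ∀ i, E.diffEqn p r I i (t, X) = 0) (hX'0 : ∀ i, E.diffEqn p r I i (t, X') = 0)
    (hagree : ∀ c : Coord (fun _ : C => l + kappa p r I),
      ((c.2 : ℕ) : ℤ) ≠ q c.1 - p r → X' c = X c) :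
    E.extEqn p r I r (t, X) = E.extEqn p r I r (t, X') := by
  set top := topCoords p q r I J l with htop
  -- the segment between the low coordinates, and its lift to the zero set
  let v : ℝ →ᵃ[ℝ] ((topᶜ : Finset _) → ℝ) := AffineMap.lineMap (topᶜ.restrict X) (topᶜ.restrict X')
  let Y : ℝ → ExtJet C l p r I := fun s => combineL p q r I J l (v s, S.phi (t, v s))
  let O : Set ℝ := v ⁻¹' S.V
  have hvd : ∀ s, HasDerivAt v (topᶜ.restrict X' - topᶜ.restrict X) s := fun s =>
    AffineMap.hasDerivAt_lineMap
  have hO : IsOpen O := S.isOpen_V.preimage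
    (continuous_iff_continuousAt.2 fun s => (hvd s).continuousAt)
  have hOc : IsPreconnected O := (S.convex_V.affine_preimage v).isPreconnected
  have hYV : ∀ s, topᶜ.restrict (Y s) = v s := fun s => restrict_compl_combineL _ _
  have hYW : ∀ s, top.restrict (Y s) = S.phi (t, v s) := fun s => restrict_combineL _ _
  have hYdom : ∀ s ∈ O, Y s ∈ S.dom := fun s hs => by
    refine ⟨?_, ?_⟩
    · rw [hYV]; exact hs
    · rw [hYW]; exact S.mapsTo_phi ⟨ht, hs⟩
  have hY0 : ∀ s ∈ O, ∀ i, E.diffEqn p r I i (t, Y s) = 0 := fun s hs =>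
    (S.zero_iff t ht (Y s) (hYdom s hs).1 (hYdom s hs).2).2 (by rw [hYW, hYV])
  have hYend : ∀ s, ∀ Z ∈ S.dom, (∀ i, E.diffEqn p r I i (t, Z) = 0) →
      v s = topᶜ.restrict Z → Y s = Z := fun s Z hZ hZ0 hs => by
    have hphi := (S.zero_iff t ht Z hZ.1 hZ.2).1 hZ0
    simp only [Y, hs]
    rw [← hphi]
    exact combineL_restrict Z
  have h0 : Y 0 = X := hYend 0 X hX hX0 (AffineMap.lineMap_apply_zero _ _)
  have h1 : Y 1 = X' := hYend 1 X' hX' hX'0 (AffineMap.lineMap_apply_one _ _)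
  have hE' : ∀ s ∈ O, (t, Y s) ∈ E.time ×ˢ E.extDom p r I := fun s hs =>
    ⟨S.time_subset ht, S.dom_subset (hYdom s hs)⟩
  have hderiv : ∀ s ∈ O, HasDerivAt (fun s => E.extEqn p r I r (t, Y s)) 0 s := by
    intro s hs
    have hφ := (S.analyticOnNhd_phi (t, v s) ⟨ht, hs⟩).differentiableAt.hasFDerivAt.comp_hasDerivAt
      s ((hasDerivAt_const s t).prodMk (hvd s))
    obtain ⟨Y', hY', hY'V⟩ : ∃ Y', HasDerivAt Y Y' s ∧
        topᶜ.restrict Y' = topᶜ.restrict X' - topᶜ.restrict X :=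
      ⟨_, (combineL p q r I J l).hasFDerivAt.comp_hasDerivAt s ((hvd s).prodMk hφ),
        restrict_compl_combineL _ _⟩
    have hoff : ∀ c : Coord (fun _ : C => l + kappa p r I),
        ((c.2 : ℕ) : ℤ) ≠ q c.1 - p r → Y' c = 0 := fun c hc => by
      have hmem : c ∈ topᶜ := Finset.mem_compl.2 fun h => hc (mem_topCoords.1 h).2
      have h2 : Y' c = X' c - X c := congrFun hY'V ⟨c, hmem⟩
      rw [h2, hagree c hc, sub_self]
    obtain ⟨w, hw, -⟩ := exists_eq_orderDir (o := fun j => q j - p r) hoff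
    have hcurve : HasDerivAt (fun s => (t, Y s)) ((0 : ℝ), Y') s :=
      (hasDerivAt_const s t).prodMk hY'
    have hrows : ∀ i ∈ I, ∑ j, E.jacobian p q
        (t, Jet.restrict (fun _ => Nat.le_add_right l _) (Y s)) i j * w j = 0 := by
      intro i hi
      rw [← fderiv_diffEqn_orderDir hE hpq ⟨i, hi⟩ (hadm.le i hi) (hE' s hs), ← hw]
      have h2 := (analyticAt_diffEqn hE ⟨i, hi⟩
        (hE' s hs)).differentiableAt.hasFDerivAt.comp_hasDerivAt s hcurve
      have h3 : (E.diffEqn p r I ⟨i, hi⟩ ∘ fun s => (t, Y s)) =ᶠ[𝓝 s] fun _ => 0 :=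
        Filter.eventually_of_mem (hO.mem_nhds hs) fun s' hs' => hY0 s' hs' ⟨i, hi⟩
      exact h2.unique ((hasDerivAt_const s (0 : ℝ)).congr_of_eventuallyEq h3)
    have hr0 := row_mulVec_eq_zero _ hadm.notMem hadm.card_eq
      (S.nonsing t ht (Y s) (hYdom s hs).1 (by rw [hYW, hYV]))
      (fun j hj hns => by
        have hcard := Finset.card_insert_of_notMem hadm.notMem
        have := hadm.rank_eq.2 ⟨insert r I, insert j J, subset_rfl, rfl, by
          rw [hcard, Finset.card_insert_of_notMem hj, hadm.card_eq],
          ⟨(t, Jet.restrict (fun _ => Nat.le_add_right l _) (Y s)),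
            ⟨S.time_subset ht, S.dom_subset (hYdom s hs)⟩, hns⟩⟩
        omega) hrows
    have h4 := (analyticAt_extEqn hE r
      (hE' s hs)).differentiableAt.hasFDerivAt.comp_hasDerivAt s hcurve
    have h5 : fderiv ℝ (E.extEqn p r I r) (t, Y s) (0, Y') = 0 := by
      rw [hw, fderiv_orderDir, ← hr0]
      exact Finset.sum_congr rfl fun j _ => by
        rw [coordDeriv_extEqn hE r (hE' s hs), jacobian_apply]
    rw [h5] at h4
    exact h4
  have hO0 : (0 : ℝ) ∈ O := by
    have := hX.1
    rwa [← h0, hYV] at this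
  have hO1 : (1 : ℝ) ∈ O := by
    have := hX'.1
    rwa [← h1, hYV] at this
  rw [← h0, ← h1]
  exact hO.is_const_of_deriv_eq_zero hOc
    (f := fun s => E.extEqn p r I r (t, Y s))
    (fun s hs => (hderiv s hs).differentiableAt.differentiableWithinAt)
    (fun s hs => (hderiv s hs).deriv) hO0 hO1

theorem psi_apply_of_ne (Ξ X : ExtJet C l p r I) (y : J → ℝ)
    (c : Coord (fun _ : C => l + kappa p r I)) (hc : ((c.2 : ℕ) : ℤ) ≠ q c.1 - p r) :
    psi p q r I J Ξ X y c = X c := if_neg hc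

theorem contDiff_restrict_psi (Ξ : ExtJet C l p r I) {n : WithTop ℕ∞} :
    ContDiff ℝ n fun X => (topCoords p q r I J l)ᶜ.restrict (psi p q r I J Ξ X 0) := by
  refine contDiff_pi.2 fun c => ?_
  simp only [Finset.restrict, psi]
  split_ifs
  · exact contDiff_const
  · exact contDiff_const
  · exact contDiff_apply ℝ ℝ _

/-- The solutions of the augmented system on `T` that extend the trajectory `x`. -/
theorem augmentation_isSolutionOn_iff (S : E.ImplicitSolution p q r I J) {Ξ : ExtJet C l p r I}
    {x : ℝ → C → ℝ} {y : ℝ → J → ℝ} {T : Set ℝ}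
    (hx : ∀ j, ContDiffOn ℝ (l + kappa p r I : ℕ) (fun t => x t j) T) (hTS : T ⊆ S.time) :
    (augmentation S Ξ).IsSolutionOn (fun τ => Sum.elim (x τ) (y τ)) T ↔
      (∀ j, ContinuousOn (fun t => y t j) T) ∧ ∀ t ∈ T,
        (ofTrajectory (fun _ => l + kappa p r I) x t ∈ S.dom ∧
          psi p q r I J Ξ (ofTrajectory (fun _ => l + kappa p r I) x t) (y t) ∈ S.dom) ∧
        (∀ i ≠ r, E.eqn i (t, ofTrajectory (fun _ => l) x t) = 0) ∧
        E.extEqn p r I r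
          (t, psi p q r I J Ξ (ofTrajectory (fun _ => l + kappa p r I) x t) (y t)) = 0 ∧
        ∀ i, E.diffEqn p r I i
          (t, psi p q r I J Ξ (ofTrajectory (fun _ => l + kappa p r I) x t) (y t)) = 0 := by
  have hxp : ∀ t, xPart (ofTrajectory (augOrder (C := C) p r I J l)
      (fun τ => Sum.elim (x τ) (y τ)) t) = ofTrajectory (fun _ => l + kappa p r I) x t :=
    fun t => rfl
  have hyp : ∀ t, yPart (ofTrajectory (augOrder (C := C) p r I J l)
      (fun τ => Sum.elim (x τ) (y τ)) t) = y t := fun t => by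
    funext j
    simp [yPart, ofTrajectory]
  unfold IsSolutionOn
  refine and_congr ?_ (forall₂_congr fun t ht => ?_)
  · rw [Sum.forall]
    constructor
    · exact fun h j => contDiffOn_zero.1 (h.2 j)
    · exact fun h => ⟨hx, fun j => contDiffOn_zero.2 (h j)⟩
  · have hdom : ofTrajectory (augOrder (C := C) p r I J l)
        (fun τ => Sum.elim (x τ) (y τ)) t ∈ (augmentation S Ξ).dom ↔
        ofTrajectory (fun _ => l + kappa p r I) x t ∈ S.dom ∧
          psi p q r I J Ξ (ofTrajectory (fun _ => l + kappa p r I) x t) (y t) ∈ S.dom := by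
      rw [← hxp t, ← hyp t]
      rfl
    have ht' : t ∈ (augmentation S Ξ).time := hTS ht
    rw [hdom, Sum.forall]
    simp only [ht', true_and]
    refine and_congr_right fun _ => ?_
    have hr : ∀ i, (augmentation S Ξ).eqn (Sum.inr i) (t, ofTrajectory (augOrder (C := C) p r I J l)
        (fun τ => Sum.elim (x τ) (y τ)) t) = E.diffEqn p r I i
          (t, psi p q r I J Ξ (ofTrajectory (fun _ => l + kappa p r I) x t) (y t)) := fun i => by
      rw [← hxp t, ← hyp t]
      rfl
    have hl : ∀ i, (augmentation S Ξ).eqn (Sum.inl i) (t, ofTrajectory (augOrder (C := C) p r I J l)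
        (fun τ => Sum.elim (x τ) (y τ)) t) = if i = r then E.extEqn p r I r
          (t, psi p q r I J Ξ (ofTrajectory (fun _ => l + kappa p r I) x t) (y t))
          else E.eqn i (t, ofTrajectory (fun _ => l) x t) := fun i => by
      rw [← hyp t]
      rfl
    simp only [hr, hl, ← and_assoc]
    refine and_congr_left fun _ => ⟨fun h => ⟨fun i hi => ?_, ?_⟩, fun h i => ?_⟩
    · have := h i
      rwa [if_neg hi] at this
    · have := h r
      rwa [if_pos rfl] at this
    · split_ifs with hi
      · exact h.2
      · exact h.1 i hi

/-- The interval is chosen so that the trajectory stays in the factor of the domain that belongs to `x`.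
There `y` has to be the implicit function, evaluated at the low coordinates of `ψ_Ξ(X, y)`, which do not
depend on `y`. -/
theorem augmentation_solutions (hE : E.IsRealAnalytic) (hpq : E.IsDualFeasible p q)
    (hadm : E.IsAdmissible p q r I J) (S : E.ImplicitSolution p q r I J) (Ξ : ExtJet C l p r I)
    (s : ℕ∞) (x : ℝ → C → ℝ)
    (hx : ContDiffOn ℝ ((((l + kappa p r I : ℕ) : ℕ∞) + s : ℕ∞) : WithTop ℕ∞) x S.time)
    (t : ℝ) (ht : t ∈ S.time) (Z : Jet (augOrder (C := C) p r I J l))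
    (hZ : Z ∈ (augmentation S Ξ).dom)
    (hxZ : ofTrajectory (fun _ => l + kappa p r I) x t = xPart Z) :
    ∃ T : Set ℝ, IsOpen T ∧ T.OrdConnected ∧ t ∈ T ∧ T ⊆ S.time ∧
      (E.IsSolutionOn x T ↔ ∃ y : ℝ → J → ℝ, ContDiffOn ℝ (s : WithTop ℕ∞) y T ∧
        (augmentation S Ξ).IsSolutionOn (fun τ => Sum.elim (x τ) (y τ)) T ∧
        ∀ y' : ℝ → J → ℝ,
          (augmentation S Ξ).IsSolutionOn (fun τ => Sum.elim (x τ) (y' τ)) T →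
          Set.EqOn y' y T) := by
  set top := topCoords p q r I J l with htop
  let X : ℝ → ExtJet C l p r I := ofTrajectory (fun _ => l + kappa p r I) x
  have hXs : ContDiffOn ℝ (s : WithTop ℕ∞) X S.time :=
    contDiffOn_ofTrajectory S.isOpen_time fun j => (contDiffOn_pi.1 hx j).of_le (by
      rw [add_comm]
      push_cast
      exact le_rfl)
  let v : ℝ → ((topᶜ : Finset _) → ℝ) := fun τ => topᶜ.restrict (psi p q r I J Ξ (X τ) 0)
  have hv : ContDiffOn ℝ (s : WithTop ℕ∞) v S.time :=
    (contDiff_restrict_psi Ξ).comp_contDiffOn hXs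
  -- near `t`, the trajectory stays in the factor of the domain that belongs to `x`
  have hU : ∀ᶠ τ in 𝓝 t, τ ∈ S.time ∧ X τ ∈ S.dom ∧ v τ ∈ S.V := by
    have hnhds := S.isOpen_time.mem_nhds ht
    refine (Filter.Eventually.and hnhds) (.and ?_ ?_)
    · refine (hXs.continuousOn.continuousAt hnhds).eventually (S.isOpen_dom.mem_nhds ?_)
      rw [show X t = xPart Z from hxZ]
      exact hZ.1
    · refine (hv.continuousOn.continuousAt hnhds).eventually (S.isOpen_V.mem_nhds ?_)
      simp only [v, show X t = xPart Z from hxZ]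
      rw [psi_restrict_compl Ξ _ 0 (yPart Z)]
      exact hZ.2.1
  obtain ⟨ε, hε, hball⟩ := Metric.eventually_nhds_iff_ball.1 hU
  have hTS : Metric.ball t ε ⊆ S.time := fun τ hτ => (hball τ hτ).1
  refine ⟨Metric.ball t ε, Metric.isOpen_ball, (convex_ball _ _).ordConnected,
    Metric.mem_ball_self hε, hTS, ?_⟩
  set T := Metric.ball t ε
  have hTo : IsOpen T := Metric.isOpen_ball
  have hTE : T ⊆ E.time := fun τ hτ => S.time_subset (hTS hτ)
  have hxj : ∀ j, ContDiffOn ℝ (l + kappa p r I : ℕ) (fun t => x t j) T := fun j =>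
    ((contDiffOn_pi.1 hx j).mono hTS).of_le (by
      push_cast
      exact le_self_add)
  have hdomE : ∀ τ ∈ T, ofTrajectory (fun _ => l) x τ ∈ E.dom := fun τ hτ =>
    S.dom_subset (hball τ hτ).2.1
  have hdiff := fun i : I => diffEqn_ofTrajectory_eq_zero (p := p) (r := r) hE hTo hTE hxj hdomE i
  -- `F_r` takes the same value at the trajectory and at any admissible `ψ`
  have hkey : ∀ τ ∈ T, (∀ i, E.diffEqn p r I i (τ, X τ) = 0) → ∀ y : J → ℝ,
      psi p q r I J Ξ (X τ) y ∈ S.dom →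
      (∀ i, E.diffEqn p r I i (τ, psi p q r I J Ξ (X τ) y) = 0) →
      E.extEqn p r I r (τ, X τ) = E.extEqn p r I r (τ, psi p q r I J Ξ (X τ) y) :=
    fun τ hτ h0 y hy hy0 => extEqn_eq_of_agree hE hpq hadm S (hTS hτ) (hball τ hτ).2.1 hy h0 hy0
      fun c hc => psi_apply_of_ne Ξ _ _ c hc
  -- the differentiated equations hold at `ψ` if and only if its top coordinates are given by `phi`
  have hzero : ∀ τ ∈ T, ∀ y : J → ℝ,
      (psi p q r I J Ξ (X τ) y ∈ S.dom ∧
        ∀ i, E.diffEqn p r I i (τ, psi p q r I J Ξ (X τ) y) = 0) ↔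
      top.restrict (psi p q r I J Ξ (X τ) y) = S.phi (τ, v τ) := by
    intro τ hτ y
    have hvy : topᶜ.restrict (psi p q r I J Ξ (X τ) y) = v τ := psi_restrict_compl Ξ _ _ _
    constructor
    · rintro ⟨h1, h2⟩
      rw [(S.zero_iff τ (hTS hτ) _ h1.1 h1.2).1 h2, hvy]
    · intro h
      have hmem : psi p q r I J Ξ (X τ) y ∈ S.dom := by
        refine ⟨?_, ?_⟩
        · rw [hvy]; exact (hball τ hτ).2.2
        · rw [h]; exact S.mapsTo_phi ⟨hTS hτ, (hball τ hτ).2.2⟩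
      exact ⟨hmem, (S.zero_iff τ (hTS hτ) _ hmem.1 hmem.2).2 (by rw [h, hvy])⟩
  obtain ⟨z, -, hz⟩ := hadm.nonsingular
  choose k hk using exists_top_order (r := r) hadm.card_eq hadm.le hz
  -- the coordinate that `y_j` replaces; these are all the top coordinates
  let idx : J → top := fun j => ⟨⟨j, k j⟩, mem_topCoords.2 ⟨j.2, hk j⟩⟩
  have hy_iff : ∀ τ (y : J → ℝ), top.restrict (psi p q r I J Ξ (X τ) y) = S.phi (τ, v τ) ↔
      y = fun j => S.phi (τ, v τ) (idx j) := by
    intro τ y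
    constructor
    · intro h
      funext j
      rw [← h]
      exact (psi_apply_of_mem Ξ (X τ) y (idx j)).symm
    · rintro rfl
      funext c
      refine (psi_apply_of_mem Ξ (X τ) _ c).trans ?_
      have h2 := mem_topCoords.1 c.2
      congr 1
      refine Subtype.ext (Sigma.ext rfl (heq_of_eq (Fin.ext ?_)))
      have h3 := hk ⟨c.1.1, h2.1⟩
      exact_mod_cast h3.trans h2.2.symm
  constructor
  · intro hsol
    have hX0 : ∀ τ ∈ T, ∀ i, E.diffEqn p r I i (τ, X τ) = 0 := fun τ hτ i =>
      hdiff i (fun τ' hτ' => (hsol.2 τ' hτ').2.2 i) τ hτ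
    have hys : ContDiffOn ℝ (s : WithTop ℕ∞) (fun τ j => S.phi (τ, v τ) (idx j)) T := by
      have h1 : ContDiffOn ℝ (s : WithTop ℕ∞) (fun τ => S.phi (τ, v τ)) T := fun τ hτ =>
        ((S.analyticOnNhd_phi (τ, v τ) ⟨hTS hτ, (hball τ hτ).2.2⟩).contDiffAt.comp_contDiffWithinAt
          τ (contDiffWithinAt_id.prodMk ((hv.mono hTS) τ hτ)))
      exact contDiffOn_pi.2 fun j => contDiffOn_pi.1 h1 (idx j)
    refine ⟨fun τ j => S.phi (τ, v τ) (idx j), hys, ?_, fun y' hy' τ hτ => ?_⟩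
    · refine (augmentation_isSolutionOn_iff S hxj hTS).2
        ⟨fun j => (contDiffOn_pi.1 hys j).continuousOn, fun τ hτ => ?_⟩
      obtain ⟨h1, h2⟩ := (hzero τ hτ _).2 ((hy_iff τ _).2 rfl)
      refine ⟨⟨(hball τ hτ).2.1, h1⟩, fun i _ => (hsol.2 τ hτ).2.2 i, ?_, h2⟩
      rw [← hkey τ hτ (hX0 τ hτ) _ h1 h2]
      exact (hsol.2 τ hτ).2.2 r
    · obtain ⟨h1, -, -, h2⟩ := ((augmentation_isSolutionOn_iff S hxj hTS).1 hy').2 τ hτ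
      exact (hy_iff τ _).1 ((hzero τ hτ _).1 ⟨h1.2, h2⟩)
  · rintro ⟨y, -, hsol, -⟩
    have h := ((augmentation_isSolutionOn_iff S hxj hTS).1 hsol).2
    refine ⟨fun j => (hxj j).of_le (by exact_mod_cast Nat.le_add_right _ _), fun τ hτ =>
      ⟨hTE hτ, hdomE τ hτ, fun i => ?_⟩⟩
    by_cases hi : i = r
    · subst hi
      obtain ⟨h1, -, h2, h3⟩ := h τ hτ
      have hX0 : ∀ i', E.diffEqn p i I i' (τ, X τ) = 0 := fun i' =>
        hdiff i' (fun τ' hτ' => (h τ' hτ').2.1 i' fun he => hadm.notMem (he ▸ i'.2)) τ hτ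
      rw [← hkey τ hτ hX0 _ h1.2 h3] at h2
      exact h2
    · exact (h τ hτ).2.1 i hi

end System

end DAE

end

theorem mainTheorem2 {R C : Type*} [Fintype R] [DecidableEq R] [Fintype C] [DecidableEq C]
    (n l : ℕ) (hR : Fintype.card R = n) (hC : Fintype.card C = n)
    (E : DAE.System R (fun _ : C => l)) (hE : E.IsRealAnalytic) (hI1 : E.HasPerfectMatching) :
    -- the dual optimal solution that the method computes exists
    (∃ (p : R → ℤ) (q : C → ℤ), E.IsDualOptimal p q ∧
      (∀ i, 0 ≤ p i ∧ p i ≤ n * l) ∧ (∀ j, 0 ≤ q j ∧ q j ≤ n * l)) ∧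
    ∀ (p : R → ℤ) (q : C → ℤ), E.IsDualOptimal p q →
      E.NonsingAtConsistent p q → E.JacobianIdenticallySingular p q →
      -- the method can be carried out
      (∃ (r : R) (I : Finset R) (J : Finset C), E.IsAdmissible p q r I J) ∧
      ∀ (r : R) (I : Finset R) (J : Finset C), E.IsAdmissible p q r I J →
        Nonempty (E.ImplicitSolution p q r I J) ∧
        ∀ S : E.ImplicitSolution p q r I J, S.time.Nonempty ∧ S.dom.Nonempty ∧
        ∀ Ξ ∈ S.dom,
          -- (A1)
          ((DAE.System.augmentation S Ξ).IsRealAnalytic ∧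
            (DAE.System.augmentation S Ξ).time ⊆ E.time ∧
            (∃ (Ω' : Set (DAE.System.ExtJet C l p r I)) (Y : Set (J → ℝ)),
              IsOpen Ω' ∧ IsOpen Y ∧ Ω' ⊆ E.extDom p r I ∧
              (DAE.System.augmentation S Ξ).dom =
                {Z | DAE.System.xPart Z ∈ Ω' ∧ DAE.System.yPart Z ∈ Y}) ∧
            ((∀ i, 0 ≤ p i ∧ p i ≤ n * l) → (∀ j, 0 ≤ q j ∧ q j ≤ n * l) →
              DAE.System.kappa p r I ≤ l * n) ∧
            I.card = J.card ∧ J.card + 1 ≤ n) ∧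
          -- (A2)
          (∀ (s : ℕ∞) (x : ℝ → C → ℝ),
            ContDiffOn ℝ ((((l + DAE.System.kappa p r I : ℕ) : ℕ∞) + s : ℕ∞) : WithTop ℕ∞) x
              (DAE.System.augmentation S Ξ).time →
            ∀ t ∈ (DAE.System.augmentation S Ξ).time, ∀ Z ∈ (DAE.System.augmentation S Ξ).dom,
            DAE.Jet.ofTrajectory _ x t = DAE.System.xPart Z →
            ∃ T' : Set ℝ, IsOpen T' ∧ T'.OrdConnected ∧ t ∈ T' ∧
              T' ⊆ (DAE.System.augmentation S Ξ).time ∧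
              (E.IsSolutionOn x T' ↔
                ∃ y : ℝ → J → ℝ, ContDiffOn ℝ (s : WithTop ℕ∞) y T' ∧
                  (DAE.System.augmentation S Ξ).IsSolutionOn
                    (fun τ => Sum.elim (x τ) (y τ)) T' ∧
                  ∀ y' : ℝ → J → ℝ,
                    (DAE.System.augmentation S Ξ).IsSolutionOn
                      (fun τ => Sum.elim (x τ) (y' τ)) T' →
                    Set.EqOn y' y T')) ∧
          -- (A3)
          ((DAE.System.augmentation S Ξ).IsDualFeasible
              (Sum.elim p fun _ => p r) (Sum.elim q fun _ => p r) ∧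
            ¬ (DAE.System.augmentation S Ξ).IsDualOptimal
              (Sum.elim p fun _ => p r) (Sum.elim q fun _ => p r) ∧
            (DAE.System.augmentation S Ξ).deltaHat + 1 ≤ E.deltaHat) := by
  have hcard : Fintype.card R = Fintype.card C := hR.trans hC.symm
  refine ⟨DAE.System.exists_isDualOptimal_bounded (fun _ => le_rfl) hR hI1,
    fun p q hpq hI2 hI3 => ⟨DAE.System.exists_isAdmissible
      (hE.2.2.1.prod hE.2.2.2.2.1) hcard hI3, fun r I J hadm => ⟨
        DAE.System.nonempty_implicitSolution hE hpq.1 hI2 hadm, fun S => ⟨⟨_, S.base_time_mem⟩,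
        ⟨_, S.base_mem_dom⟩, fun Ξ hΞ => ⟨⟨DAE.System.augmentation_isRealAnalytic S hE hΞ,
          S.time_subset, DAE.System.exists_augmentation_dom_eq_prod S Ξ, fun hp _ => ?_,
          hadm.card_eq, ?_⟩,
          DAE.System.augmentation_solutions hE hpq.1 hadm S Ξ,
          DAE.System.augmentation_dual S hE hpq hadm.le hadm.card_eq Ξ⟩⟩⟩⟩⟩
  · refine Finset.sup_le fun i _ => ?_
    have h1 := (hp i).2
    have h2 := (hp r).1
    have h3 : ((l * n : ℕ) : ℤ) = n * l := by push_cast; ring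
    omega
  · rw [← hadm.card_eq, ← Finset.card_insert_of_notMem hadm.notMem, ← hR]
    exact Finset.card_le_univ _
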